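/- Let $q>7$ be a prime power with $q\equiv 7\pmod{10}$, and put $n=\frac{q^2+1}{10}$, $r=q+1$, $s=\frac{q^2+1}{2}$. Let $\alpha\in\mathbb F_{q^2}$ be a primitive $r$-th root of unity, and let $\delta$, in an extension field of $\mathbb F_{q^2}$, be a primitive $rn$-th root of unity with $\delta^n=\alpha$. For an integer $i$ let $C_i=\{iq^{2j} \bmod rn : j\in\mathbb Z\}$ be its $q^2$-cyclotomic coset modulo $rn$. An $\alpha$-constacyclic code $\mathcal C\subseteq\mathbb F_{q^2}^n$ is an ideal of $\mathbb F_{q^2}[x]/(x^n-\alpha)$, generated by a monic divisor $g$ of $x^n-\alpha$; its defining set is the set of all $i\in\{1+rj: 0\le j\le n-1\}$, taken modulo $rn$, with $g(\delta^i)=0$. Let $\lambda$ be an integer with $1\le\lambda\le\frac{q+3}{10}$, and let $\mathcal C$ be the $\alpha$-constacyclic code of length $n$ over $\mathbb F_{q^2}$ with defining set $$Z=\bigcup_{j=0}^{\frac{3(q-7)}{10}+1+\lambda} C_{s-rj}.$$ Put $k=n-\frac65(q-7)-4\lambda-1$ and $d=\frac35(q-7)+2\lambda+4$. Then: 1. $Z\cap(-qZ)=C_s\cup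 C_{s-r\frac{3q-1}{10}}\cup C_{s-r\frac{q+3}{10}}$, and this set has exactly $5$ elements (here $-qZ=\{-qz \bmod rn: z\in Z\}$). 2. $\mathcal C$ is an MDS code of dimension $n-d+1$ and minimum distance $d$, and $\operatorname{rank}(HH^*)=5$ for every $(d-1)\times n$ parity check matrix $H$ of $\mathcal C$, where $H^*$ is the conjugate transpose of $H$ with respect to $x\mapsto x^q$. 3. There exists an EAQMDS code with parameters $[[n,k,d;5]]_q$, that is, $$\Bigl[\Bigl[n,\ n-\tfrac65(q-7)-4\lambda-1,\ \tfrac35(q-7)+2\lambda+4;\ 5\Bigr]\Bigr]_q .$$ Here an entanglement-assisted quantum code $[[n,k,d;c]]_q$ encodes $k$ qudits of dimension $q$ into $n$ qudits: the sender applies an isometry $V:(\mathbb C^q)^{\otimes k}\otimes(\mathbb C^q)^{\otimes c}\to(\mathbb C^q)^{\otimes n}$ to the information qudits and her halves of $c$ maximally entangled pairs of qudits shared with the receiver, whose halves are free of errors. Its minimum distance is $d$ if $P(E\otimes 1)P$ is a scalar multiple of $P$ (the orthogonal projection onto the code space in $(\mathbb C^q)^{\otimes n}\otimes(\mathbb C^q)^{\otimes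 c}$) for every operator $E$ that acts on fewer than $d$ of the $n$ qudits, but not for every $E$ that acts on $d$ of them. It is an EAQMDS code if $d\le\frac{n+2}{2}$ and $n+c-k=2(d-1)$. -/

import Mathlib

open scoped Matrix Kronecker

/-! ### Constacyclic codes -/

/-- The constacyclic shift `(c₀, …, c_{n-1}) ↦ (α c_{n-1}, c₀, …, c_{n-2})`. -/
def constacyclicShift {F : Type*} [Field F] {n : ℕ} (α : F) (c : Fin n → F) : Fin n → F :=
  fun i =>
    if i.val = 0 then α * c ⟨n - 1, by have := i.isLt; omega⟩
    else c ⟨i.val - 1, by have := i.isLt; omega⟩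

/-- A linear code is `α`-constacyclic if it is closed under the `α`-constacyclic shift. -/
def IsConstacyclic {F : Type*} [Field F] {n : ℕ} (α : F) (C : Submodule F (Fin n → F)) : Prop :=
  ∀ c ∈ C, constacyclicShift α c ∈ C

/-- The polynomial `c₀ + c₁ x + ⋯ + c_{n-1} x^{n-1}` of a word. -/
noncomputable def wordPoly {F : Type*} [Field F] {n : ℕ} (c : Fin n → F) : Polynomial F :=
  ∑ i, Polynomial.monomial i.val (c i)

/-- `g` is the monic divisor of `x ^ n - α` that generates `C`, as an ideal of
`F[x] / (x ^ n - α)`: the codewords are the words whose polynomial is a multiple of `g`. -/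
def IsGeneratorPoly {F : Type*} [Field F] {n : ℕ} (α : F) (C : Submodule F (Fin n → F))
    (g : Polynomial F) : Prop :=
  g.Monic ∧ g ∣ Polynomial.X ^ n - Polynomial.C α ∧ ∀ c : Fin n → F, c ∈ C ↔ g ∣ wordPoly c

/-- The exponents `{1 + r j | 0 ≤ j ≤ n - 1}` modulo `r n`. -/
def exponentSet (r n : ℕ) : Set (ZMod (r * n)) :=
  {i | ∃ j : ℕ, j < n ∧ i = 1 + (r : ZMod (r * n)) * j}

/-- `Z` is the defining set of the `α`-constacyclic code `C` with respect to the `r n`-th root of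
unity `δ` (which lives in an extension field `K` of `F`): the set of exponents `i ≡ 1 (mod r)`,
taken modulo `r n`, for which `δ ^ i` is a root of the generator polynomial of `C`. -/
def HasDefiningSet {F K : Type*} [Field F] [Field K] [Algebra F K] {n : ℕ} (r : ℕ) (α : F) (δ : K)
    (C : Submodule F (Fin n → F)) (Z : Set (ZMod (r * n))) : Prop :=
  ∃ g : Polynomial F, IsGeneratorPoly α C g ∧
    Z = {i | i ∈ exponentSet r n ∧ Polynomial.aeval (δ ^ i.val) g = 0}

/-- The `q²`-cyclotomic coset of `i` modulo `m`. (For `q` prime to `m`, multiplication by `q²` has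
finite order, so nonnegative exponents give the same set as all integer exponents.) -/
def cyclotomicCoset (q m : ℕ) (i : ZMod m) : Set (ZMod m) :=
  {x | ∃ j : ℕ, x = i * (q : ZMod m) ^ (2 * j)}

/-- The set `-q Z` modulo `m`. -/
def negMulSet (q : ℕ) {m : ℕ} (Z : Set (ZMod m)) : Set (ZMod m) :=
  (fun z => -((q : ZMod m) * z)) '' Z

/-- `d` is the minimum weight of the nonzero codewords of `C`. -/
def IsMinWeight {F : Type*} [Field F] [DecidableEq F] {n : ℕ} (C : Submodule F (Fin n → F))
    (d : ℕ) : Prop :=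
  IsLeast {w | ∃ c ∈ C, c ≠ 0 ∧ hammingNorm c = w} d

/-- `H` is a parity check matrix of the code `C`: it has `n - dim C` rows and kernel `C`. -/
def IsParityCheck {F : Type*} [Field F] {m n : ℕ} (C : Submodule F (Fin n → F))
    (H : Matrix (Fin m) (Fin n) F) : Prop :=
  Module.finrank F C + m = n ∧ ∀ v : Fin n → F, v ∈ C ↔ H *ᵥ v = 0

/-- The conjugate transpose of a matrix over the field with `q²` elements, where conjugation is
`x ↦ x ^ q`. -/
def hermTranspose {F : Type*} [Field F] {m n : ℕ} (q : ℕ) (H : Matrix (Fin m) (Fin n) F) :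
    Matrix (Fin n) (Fin m) F :=
  (H.map (fun x => x ^ q))ᵀ

/-! ### Entanglement-assisted quantum codes

`m` qudits with computational basis labelled by the alphabet `A` have the state space
`(Fin m → A) → ℂ`, with the inner product `star φ ⬝ᵥ ψ`. -/

/-- An entanglement-assisted quantum code that encodes `k` qudits into `n` qudits with the help of
`c` maximally entangled pairs of qudits shared by sender and receiver. The sender applies an
isometry to the `k` information qudits and to her halves of the `c` pairs (equivalently: a unitary
operator on these `k + c` qudits and `n - k - c` ancillas in a fixed state), and transmits the
resulting `n` qudits. -/
structure EAQECC (A : Type*) [Fintype A] [DecidableEq A] (n k c : ℕ) where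
  /-- the matrix of the encoding isometry -/
  encoder : Matrix (Fin n → A) ((Fin k → A) × (Fin c → A)) ℂ
  isometry : encoderᴴ * encoder = 1

namespace EAQECC

variable {A : Type*} [Fintype A] [DecidableEq A] {n k c : ℕ}

/-- The encoding map. It sends `ψ` to the joint state of the `n` transmitted qudits and of the
receiver's halves of the `c` pairs, that is, to `(V ⊗ 1) (ψ ⊗ Φ)`, where `V` is the encoding
isometry and `Φ = |A| ^ (-c / 2) ∑_b |b⟩ |b⟩` is the state of the `c` pairs. -/
noncomputable def encode (Q : EAQECC A n k c) :
    ((Fin k → A) → ℂ) →ₗ[ℂ] ((Fin n → A) × (Fin c → A) → ℂ) where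
  toFun ψ := fun p =>
    ((Real.sqrt ((Fintype.card A : ℝ) ^ c) : ℝ) : ℂ)⁻¹ * ∑ u, Q.encoder p.1 (u, p.2) * ψ u
  map_add' ψ φ := by
    funext p
    simp only [Pi.add_apply, mul_add, Finset.sum_add_distrib]
  map_smul' a ψ := by
    funext p
    simp only [Pi.smul_apply, smul_eq_mul, RingHom.id_apply, Finset.mul_sum]
    refine Finset.sum_congr rfl fun u _ => ?_
    ring

/-- The code space, a subspace of the joint state space of the `n` transmitted qudits and the
receiver's `c` qudits. -/
noncomputable def codeSpace (Q : EAQECC A n k c) :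
    Submodule ℂ ((Fin n → A) × (Fin c → A) → ℂ) :=
  LinearMap.range Q.encode

/-- The operator `E` on `n` qudits acts only on the qudits with position in `S`: it is
`M ⊗ 1` for an operator `M` on these qudits. -/
def ActsOn (S : Finset (Fin n)) (E : Matrix (Fin n → A) (Fin n → A) ℂ) : Prop :=
  ∃ M : Matrix (S → A) (S → A) ℂ, ∀ x y : Fin n → A,
    E x y = if ∀ i, i ∉ S → x i = y i then M (fun i => x i) (fun i => y i) else 0

/-- The code detects the error `E` on the transmitted qudits (the receiver's halves of the pairs
are free of errors): `P (E ⊗ 1) P = z P` for a scalar `z`, where `P` is the orthogonal projection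
onto the code space. -/
def Detects (Q : EAQECC A n k c) (E : Matrix (Fin n → A) (Fin n → A) ℂ) : Prop :=
  ∃ z : ℂ, ∀ φ ∈ Q.codeSpace, ∀ ψ ∈ Q.codeSpace,
    star φ ⬝ᵥ ((E ⊗ₖ (1 : Matrix (Fin c → A) (Fin c → A) ℂ)) *ᵥ ψ) = z * (star φ ⬝ᵥ ψ)

/-- The code has minimum distance `d`: it detects every error that acts on fewer than `d` of the
transmitted qudits, but not every error that acts on `d` of them. -/
def HasMinDist (Q : EAQECC A n k c) (d : ℕ) : Prop :=
  (∀ (S : Finset (Fin n)) (E : Matrix (Fin n → A) (Fin n → A) ℂ),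
      S.card < d → ActsOn S E → Q.Detects E) ∧
    ∃ (S : Finset (Fin n)) (E : Matrix (Fin n → A) (Fin n → A) ℂ),
      S.card = d ∧ ActsOn S E ∧ ¬ Q.Detects E

end EAQECC

/-- There is an EAQMDS code with parameters `[[n, k, d; c]]_q`: an entanglement-assisted code with
these parameters, with `d ≤ (n + 2) / 2`, that meets the entanglement-assisted Singleton bound
`n + c - k ≥ 2 (d - 1)` with equality. -/
def ExistsEAQMDS (q n k d c : ℕ) : Prop :=
  (∃ Q : EAQECC (Fin q) n k c, Q.HasMinDist d) ∧
    (d : ℚ) ≤ ((n : ℚ) + 2) / 2 ∧ (n : ℚ) + c - k = 2 * ((d : ℚ) - 1)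

/-!
Since `n` divides `s` and `q ^ 2 + 1`, the set `Z` consists of the exponents `s + r t` with
`|t| ≤ T`, where `T` is the upper limit of the union, and `z ↦ -q z` acts on them as `t ↦ -q t`
modulo `n`. With `a = (q + 3) / 10` and `b = (3 q - 1) / 10` we have `n = a ^ 2 + b ^ 2`,
`q a ≡ b` and `q b ≡ -a`, so that the solutions of `t ≡ -q t'` form the square lattice spanned
by the orthogonal vectors `(a, b)` and `(b, -a)`. As `T < a + b`, only `0`, `± (a, b)` and
`± (b, -a)` have both coordinates bounded by `T`.

The exponents in `Z` are consecutive, so the BCH bound meets the Singleton bound. Over the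
extension field, `H` is equivalent to the matrix with rows `(δ ^ (z l))_l`, `z ∈ Z`. For these
rows `H H^*` becomes a matrix with entries `n` where `z = -q z'` and `0` elsewhere, which has
rank `|Z ∩ -q Z|`.

For the quantum code, view the Hermitian dual of `C` as a symplectic space `D` of Weyl labels
over the field with `q` elements. A maximal isotropic `I ≤ D` gives a stabilizer code, and the
basis states of the shared pairs displace it by the elements of a complement of `I` in `D`. A
Weyl operator goes undetected only if its label lies in the symplectic complement of `D`, which
is `C`, and is not in `I`. A word of minimum weight outside `D` exists because two words of `C`
whose supports meet in one position are not orthogonal.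
-/

/-! ### Error detection -/

namespace EAQECC

variable {A : Type*} [Fintype A] [DecidableEq A] {n k c : ℕ}

/-- The part of the encoding isometry that belongs to the basis state `b` of the `c` pairs. -/
def block (Q : EAQECC A n k c) (b : Fin c → A) : Matrix (Fin n → A) (Fin k → A) ℂ :=
  Matrix.of fun x u => Q.encoder x (u, b)

/-- The compression of an operator on the transmitted qudits to the code space, up to the factor
`|A| ^ c` and with the code space identified with the state space of the information qudits. -/
noncomputable def compression (Q : EAQECC A n k c) :
    Matrix (Fin n → A) (Fin n → A) ℂ →ₗ[ℂ] Matrix (Fin k → A) (Fin k → A) ℂ where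
  toFun E := ∑ b, (Q.block b)ᴴ * E * Q.block b
  map_add' E E' := by simp only [Matrix.mul_add, Matrix.add_mul, Finset.sum_add_distrib]
  map_smul' z E := by
    simp only [Matrix.mul_smul, Matrix.smul_mul, Finset.smul_sum, RingHom.id_apply]

theorem compression_apply (Q : EAQECC A n k c) (E : Matrix (Fin n → A) (Fin n → A) ℂ) :
    Q.compression E = ∑ b, (Q.block b)ᴴ * E * Q.block b := rfl

theorem block_conjTranspose_mul_block (Q : EAQECC A n k c) (b : Fin c → A) :
    (Q.block b)ᴴ * Q.block b = 1 := by
  ext u v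
  simpa [Matrix.mul_apply, Matrix.one_apply, block] using congr($(Q.isometry) (u, b) (v, b))

theorem compression_one (Q : EAQECC A n k c) :
    Q.compression 1 = (Fintype.card A : ℂ) ^ c • 1 := by
  simp only [compression_apply, Matrix.mul_one, block_conjTranspose_mul_block, Finset.sum_const,
    Finset.card_univ, Fintype.card_fun, Fintype.card_fin, ← Nat.cast_smul_eq_nsmul ℂ, Nat.cast_pow]

theorem kronecker_one_mulVec_encode (Q : EAQECC A n k c) (E : Matrix (Fin n → A) (Fin n → A) ℂ)
    (ψ : (Fin k → A) → ℂ) (x : Fin n → A) (b : Fin c → A) :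
    ((E ⊗ₖ (1 : Matrix (Fin c → A) (Fin c → A) ℂ)) *ᵥ Q.encode ψ) (x, b) =
      ((√((Fintype.card A : ℝ) ^ c) : ℝ) : ℂ)⁻¹ * ((E * Q.block b) *ᵥ ψ) x := by
  have encode_apply (y b) : Q.encode ψ (y, b) =
      ((√((Fintype.card A : ℝ) ^ c) : ℝ) : ℂ)⁻¹ * (Q.block b *ᵥ ψ) y := rfl
  rw [← Matrix.mulVec_mulVec]
  simp only [Matrix.mulVec, dotProduct, Fintype.sum_prod_type, Matrix.kroneckerMap_apply,
    Matrix.one_apply, encode_apply, mul_ite, mul_one, mul_zero, ite_mul, zero_mul,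
    Finset.sum_ite_eq, Finset.mem_univ, if_true]
  rw [Finset.mul_sum]
  exact Finset.sum_congr rfl fun y _ => by ring

theorem star_encode_dotProduct (Q : EAQECC A n k c) (E : Matrix (Fin n → A) (Fin n → A) ℂ)
    (φ ψ : (Fin k → A) → ℂ) :
    star (Q.encode φ) ⬝ᵥ ((E ⊗ₖ (1 : Matrix (Fin c → A) (Fin c → A) ℂ)) *ᵥ Q.encode ψ) =
      ((Fintype.card A : ℂ) ^ c)⁻¹ * (star φ ⬝ᵥ (Q.compression E *ᵥ ψ)) := by
  set t : ℂ := ((√((Fintype.card A : ℝ) ^ c) : ℝ) : ℂ)⁻¹ with ht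
  have star_mul_self : star t * t = ((Fintype.card A : ℂ) ^ c)⁻¹ := by
    rw [ht, star_inv₀, Complex.star_def, Complex.conj_ofReal, ← mul_inv, ← Complex.ofReal_mul,
      Real.mul_self_sqrt (by positivity)]
    push_cast
    rfl
  have encode_apply (x b) : Q.encode φ (x, b) = t * (Q.block b *ᵥ φ) x := rfl
  have dotProduct_block (b) : star φ ⬝ᵥ (((Q.block b)ᴴ * E * Q.block b) *ᵥ ψ) =
      star (Q.block b *ᵥ φ) ⬝ᵥ ((E * Q.block b) *ᵥ ψ) := by
    rw [Matrix.mul_assoc, ← Matrix.mulVec_mulVec, Matrix.dotProduct_mulVec, ← Matrix.star_mulVec]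
  rw [compression_apply, Matrix.sum_mulVec, dotProduct_sum, Finset.mul_sum, dotProduct,
    Fintype.sum_prod_type_right]
  refine Finset.sum_congr rfl fun b _ => ?_
  rw [dotProduct_block, dotProduct, Finset.mul_sum]
  refine Finset.sum_congr rfl fun x _ => ?_
  rw [kronecker_one_mulVec_encode, ← ht, Pi.star_apply, encode_apply, ← star_mul_self, star_mul,
    Pi.star_apply]
  ring

theorem star_encode_dotProduct_encode [Nonempty A] (Q : EAQECC A n k c) (φ ψ : (Fin k → A) → ℂ) :
    star (Q.encode φ) ⬝ᵥ Q.encode ψ = star φ ⬝ᵥ ψ := by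
  have card_ne_zero : (Fintype.card A : ℂ) ^ c ≠ 0 := pow_ne_zero _ (by simp)
  simpa [compression_one, Matrix.smul_mulVec, card_ne_zero] using Q.star_encode_dotProduct 1 φ ψ

theorem detects_iff [Nonempty A] (Q : EAQECC A n k c) (E : Matrix (Fin n → A) (Fin n → A) ℂ) :
    Q.Detects E ↔ Q.compression E ∈ ℂ ∙ (1 : Matrix (Fin k → A) (Fin k → A) ℂ) := by
  have card_ne_zero : (Fintype.card A : ℂ) ^ c ≠ 0 := pow_ne_zero _ (by simp)
  rw [Submodule.mem_span_singleton]
  constructor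
  · rintro ⟨z, hz⟩
    refine ⟨(Fintype.card A : ℂ) ^ c * z, ?_⟩
    ext u v
    have huv := hz _ ⟨Pi.single u 1, rfl⟩ _ ⟨Pi.single v 1, rfl⟩
    rw [star_encode_dotProduct, star_encode_dotProduct_encode,
      inv_mul_eq_iff_eq_mul₀ card_ne_zero] at huv
    simpa [Matrix.one_apply, Pi.single_apply, mul_assoc, Pi.star_single, eq_comm] using huv.symm
  · rintro ⟨z, hz⟩
    refine ⟨((Fintype.card A : ℂ) ^ c)⁻¹ * z, ?_⟩
    rintro _ ⟨φ, rfl⟩ _ ⟨ψ, rfl⟩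
    rw [star_encode_dotProduct, star_encode_dotProduct_encode, ← hz, Matrix.smul_mulVec,
      Matrix.one_mulVec, dotProduct_smul, smul_eq_mul, mul_assoc]

theorem Detects.of_mem_span [Nonempty A] {Q : EAQECC A n k c}
    {s : Set (Matrix (Fin n → A) (Fin n → A) ℂ)} (hs : ∀ E ∈ s, Q.Detects E)
    {E : Matrix (Fin n → A) (Fin n → A) ℂ} (hE : E ∈ Submodule.span ℂ s) : Q.Detects E := by
  have span_le : Submodule.span ℂ s ≤ (ℂ ∙ 1).comap Q.compression :=
    Submodule.span_le.2 fun E hE => (Q.detects_iff E).1 (hs E hE)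
  exact (Q.detects_iff E).2 (span_le hE)

end EAQECC

/-! ### Weyl operators -/

section Weyl

variable {R ι : Type*} [CommRing R] [Fintype ι]

/-- The standard symplectic form on `(R × R) ^ ι`. -/
def symplecticForm (R ι : Type*) [CommRing R] [Fintype ι] : LinearMap.BilinForm R (ι → R × R) :=
  ∑ i, ((LinearMap.mul R R).compl₁₂ (.snd R R R ∘ₗ .proj i) (.fst R R R ∘ₗ .proj i) -
    (LinearMap.mul R R).compl₁₂ (.fst R R R ∘ₗ .proj i) (.snd R R R ∘ₗ .proj i))

theorem symplecticForm_apply (e f : ι → R × R) :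
    symplecticForm R ι e f = ∑ i, ((e i).2 * (f i).1 - (e i).1 * (f i).2) := by
  simp [symplecticForm, LinearMap.sum_apply]

theorem symplecticForm_isAlt : (symplecticForm R ι).IsAlt := fun e => by
  simp [symplecticForm_apply, mul_comm]

theorem symplecticForm_swap (e f : ι → R × R) :
    symplecticForm R ι f e = -symplecticForm R ι e f := by
  rw [← symplecticForm_isAlt.neg_eq f e, neg_neg]

theorem symplecticForm_nondegenerate : (symplecticForm R ι).Nondegenerate := by
  classical
  have separatingLeft (e : ι → R × R) (he : ∀ f, symplecticForm R ι e f = 0) : e = 0 := by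
    funext i
    have hfst := he (Pi.single i (0, 1))
    have hsnd := he (Pi.single i (1, 0))
    rw [symplecticForm_apply, Finset.sum_eq_single_of_mem i (Finset.mem_univ i)
      (fun j _ hj => by simp [Pi.single_eq_of_ne hj])] at hfst hsnd
    exact Prod.ext (by simpa using hfst) (by simpa using hsnd)
  refine ⟨separatingLeft, fun e he => separatingLeft e fun f => ?_⟩
  rw [symplecticForm_swap, he f, neg_zero]

theorem exists_addChar_two_mul_ne_one {χ : AddChar R ℂ} (hχ : χ.IsPrimitive)
    (h2 : IsUnit (2 : R)) {t : R} (ht : t ≠ 0) : ∃ a, χ (2 * (a * t)) ≠ 1 := by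
  obtain ⟨a, ha⟩ := AddChar.ne_one_iff.1 (hχ (h2.mul_right_eq_zero.not.2 ht))
  exact ⟨a, by rwa [AddChar.mulShift_apply, mul_assoc, mul_comm t] at ha⟩

variable [DecidableEq R] (χ : AddChar R ℂ)

/-- The Weyl operator of the error `e`, whose component `(a, b)` in a position shifts the label
there by `a` and multiplies by a phase that depends on `b`. Evaluating the phase at the sum of the
old and the new label makes `weyl χ e` a unitary operator with inverse `weyl χ (-e)`. -/
def weyl (e : ι → R × R) : Matrix (ι → R) (ι → R) ℂ :=
  Matrix.of fun x y =>
    if ∀ i, x i = y i + (e i).1 then χ (∑ i, (e i).2 * (x i + y i)) else 0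

theorem weyl_apply (e : ι → R × R) (x y : ι → R) :
    weyl χ e x y = if ∀ i, x i = y i + (e i).1 then χ (∑ i, (e i).2 * (x i + y i)) else 0 := rfl

theorem weyl_zero : weyl χ (0 : ι → R × R) = 1 := by
  ext x y
  simp [weyl_apply, Matrix.one_apply, ← funext_iff]

theorem conjTranspose_weyl [Finite R] (e : ι → R × R) : (weyl χ e)ᴴ = weyl χ (-e) := by
  ext x y
  have shift_iff : (∀ i, y i = x i + (e i).1) ↔ ∀ i, x i = y i + ((-e) i).1 :=
    forall_congr' fun i => by simp [← sub_eq_add_neg, eq_sub_iff_add_eq, eq_comm]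
  rw [Matrix.conjTranspose_apply, weyl_apply, weyl_apply, ← if_congr shift_iff rfl rfl,
    apply_ite star, star_zero, Complex.star_def, ← AddChar.map_neg_eq_conj,
    ← Finset.sum_neg_distrib]
  simp [add_comm]

variable [Fintype R] [DecidableEq ι]

theorem weyl_mul (e f : ι → R × R) :
    weyl χ e * weyl χ f = χ (symplecticForm R ι e f) • weyl χ (e + f) := by
  ext x y
  have shift_iff : (∀ i, x i = y i + (f i).1 + (e i).1) ↔ ∀ i, x i = y i + ((e + f) i).1 :=
    forall_congr' fun i => by rw [Pi.add_apply, Prod.fst_add, add_assoc, add_comm (e i).1]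
  rw [Matrix.mul_apply, Finset.sum_eq_single_of_mem (fun i => y i + (f i).1) (Finset.mem_univ _),
    weyl_apply χ f, if_pos fun i => rfl, weyl_apply, Matrix.smul_apply, weyl_apply,
    if_congr shift_iff rfl rfl, smul_eq_mul]
  · split_ifs with h
    · rw [← AddChar.map_add_eq_mul, ← AddChar.map_add_eq_mul, symplecticForm_apply,
        ← Finset.sum_add_distrib, ← Finset.sum_add_distrib]
      congr 1
      refine Finset.sum_congr rfl fun i _ => ?_
      rw [h i, Pi.add_apply, Prod.fst_add, Prod.snd_add]
      ring
    · rw [zero_mul, mul_zero]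
  · intro z _ hz
    rw [weyl_apply χ f, if_neg fun h => hz (funext h), mul_zero]

theorem weyl_neg_mul_self (f : ι → R × R) : weyl χ (-f) * weyl χ f = 1 := by
  rw [weyl_mul, map_neg, LinearMap.neg_apply, symplecticForm_isAlt f, neg_zero,
    AddChar.map_zero_eq_one, one_smul, neg_add_cancel, weyl_zero]

theorem weyl_neg_mul_mul (f e : ι → R × R) :
    weyl χ (-f) * weyl χ e * weyl χ f = χ (2 * symplecticForm R ι e f) • weyl χ e := by
  rw [weyl_mul, Matrix.smul_mul, weyl_mul, smul_smul, ← AddChar.map_add_eq_mul]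
  congr 2
  · rw [map_add, map_neg, LinearMap.add_apply, LinearMap.neg_apply, LinearMap.neg_apply,
      symplecticForm_isAlt f, symplecticForm_swap e f]
    ring
  · abel

theorem weyl_mul_comm (e f : ι → R × R) :
    weyl χ e * weyl χ f = χ (2 * symplecticForm R ι e f) • (weyl χ f * weyl χ e) := by
  rw [weyl_mul, weyl_mul, smul_smul, ← AddChar.map_add_eq_mul, symplecticForm_swap e f,
    add_comm e f]
  congr 2
  ring

variable {χ}

theorem trace_weyl (hχ : χ.IsPrimitive) (h2 : IsUnit (2 : R)) {e : ι → R × R} (he : e ≠ 0) :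
    (weyl χ e).trace = 0 := by
  obtain ⟨f, hf⟩ : ∃ f, symplecticForm R ι e f ≠ 0 := by
    by_contra! h
    exact he (symplecticForm_nondegenerate.1 e h)
  obtain ⟨a, ha⟩ := exists_addChar_two_mul_ne_one hχ h2 hf
  have weyl_mul_neg_self : weyl χ (a • f) * weyl χ (-(a • f)) = 1 := by
    simpa only [neg_neg] using weyl_neg_mul_self χ (-(a • f))
  have h := congrArg Matrix.trace (weyl_neg_mul_mul χ (a • f) e)
  rw [Matrix.mul_assoc, Matrix.trace_mul_comm, Matrix.mul_assoc,
    weyl_mul_neg_self, Matrix.mul_one, Matrix.trace_smul, map_smul,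
    smul_eq_mul, smul_eq_mul] at h
  by_contra h0
  exact ha (mul_right_cancel₀ h0 (by rw [one_mul, ← h]))

end Weyl

section Span

variable {R ι : Type*} [CommRing R] [Finite R] [DecidableEq R] [Fintype ι] {χ : AddChar R ℂ}

theorem linearIndependent_weyl (hχ : χ.IsPrimitive) (h2 : IsUnit (2 : R)) :
    LinearIndependent ℂ (weyl χ : (ι → R × R) → Matrix (ι → R) (ι → R) ℂ) := by
  classical
  have := Fintype.ofFinite R
  rw [Fintype.linearIndependent_iff]
  intro z hz f
  have trace_eq (e : ι → R × R) :
      (z e • (weyl χ (-f) * weyl χ e)).trace = if e = f then z f * Fintype.card (ι → R) else 0 := by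
    split_ifs with h
    · rw [h, weyl_neg_mul_self, Matrix.trace_smul, Matrix.trace_one, smul_eq_mul]
    · rw [weyl_mul, Matrix.trace_smul, Matrix.trace_smul,
        trace_weyl hχ h2 (neg_add_eq_zero.not.2 (Ne.symm h)), smul_zero, smul_zero]
  have h : (weyl χ (-f) * ∑ e, z e • weyl χ e).trace = z f * Fintype.card (ι → R) := by
    simp_rw [Matrix.mul_sum, Matrix.mul_smul, Matrix.trace_sum, trace_eq]
    rw [Finset.sum_ite_eq' _ _ _, if_pos (Finset.mem_univ f)]
  rw [hz, Matrix.mul_zero, Matrix.trace_zero] at h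
  exact (mul_eq_zero.1 h.symm).resolve_right (Nat.cast_ne_zero.2 Fintype.card_ne_zero)

theorem span_range_weyl (hχ : χ.IsPrimitive) (h2 : IsUnit (2 : R)) :
    Submodule.span ℂ (Set.range (weyl χ : (ι → R × R) → Matrix (ι → R) (ι → R) ℂ)) = ⊤ := by
  classical
  have := Fintype.ofFinite R
  exact (linearIndependent_weyl hχ h2).span_eq_top_of_card_eq_finrank' <| by
    simp [Module.finrank_matrix, mul_pow]

end Span

section LocalOperator

variable {R : Type*} [DecidableEq R] {n : ℕ}

/-- The operator `M ⊗ 1` on `n` qudits, for an operator `M` on the qudits with position in `S`. -/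
def localOperator (S : Finset (Fin n)) :
    Matrix (S → R) (S → R) ℂ →ₗ[ℂ] Matrix (Fin n → R) (Fin n → R) ℂ where
  toFun M := Matrix.of fun x y =>
    if ∀ i, i ∉ S → x i = y i then M (fun i => x i) (fun i => y i) else 0
  map_add' M N := by
    ext x y
    simp [← ite_add_zero]
  map_smul' z M := by
    ext x y
    simp

theorem EAQECC.actsOn_iff {S : Finset (Fin n)}
    {E : Matrix (Fin n → R) (Fin n → R) ℂ} :
    EAQECC.ActsOn S E ↔ E ∈ LinearMap.range (localOperator S) := by
  simp only [EAQECC.ActsOn, LinearMap.mem_range, ← Matrix.ext_iff, eq_comm (b := E _ _)]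
  rfl

variable [CommRing R] {χ : AddChar R ℂ}

theorem localOperator_weyl (S : Finset (Fin n)) {e : Fin n → R × R}
    (he : ∀ i, i ∉ S → e i = 0) :
    localOperator S (weyl χ fun i : S => e i) = weyl χ e := by
  ext x y
  have shift_iff : ((∀ i, i ∉ S → x i = y i) ∧ ∀ i : S, x i = y i + (e i).1) ↔
      ∀ i, x i = y i + (e i).1 := by
    refine ⟨fun h i => ?_, fun h => ⟨fun i hi => by simpa [he i hi] using h i, fun i => h i⟩⟩
    by_cases hi : i ∈ S
    · exact h.2 ⟨i, hi⟩
    · simpa [he i hi] using h.1 i hi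
  have sum_eq : ∑ i : S, (e i).2 * (x i + y i) = ∑ i, (e i).2 * (x i + y i) := by
    rw [Finset.sum_coe_sort S fun i => (e i).2 * (x i + y i)]
    exact Finset.sum_subset (Finset.subset_univ _) fun i _ hi => by simp [he i hi]
  simp only [localOperator, LinearMap.coe_mk, AddHom.coe_mk, Matrix.of_apply, weyl_apply, sum_eq,
    ← ite_and, shift_iff]
  congr

theorem actsOn_weyl {S : Finset (Fin n)} {e : Fin n → R × R} (he : ∀ i, i ∉ S → e i = 0) :
    EAQECC.ActsOn S (weyl χ e) :=
  EAQECC.actsOn_iff.2 ⟨_, localOperator_weyl S he⟩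

theorem EAQECC.ActsOn.mem_span_weyl [Finite R] (hχ : χ.IsPrimitive) (h2 : IsUnit (2 : R))
    {S : Finset (Fin n)} {E : Matrix (Fin n → R) (Fin n → R) ℂ} (hE : EAQECC.ActsOn S E) :
    E ∈ Submodule.span ℂ (weyl χ '' {e : Fin n → R × R | ∀ i, i ∉ S → e i = 0}) := by
  obtain ⟨M, rfl⟩ := EAQECC.actsOn_iff.1 hE
  have hM : M ∈ Submodule.span ℂ (Set.range (weyl χ : (S → R × R) → _)) :=
    span_range_weyl (ι := S) hχ h2 ▸ Submodule.mem_top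
  have h := Submodule.mem_map_of_mem (f := localOperator S) hM
  rw [Submodule.map_span, ← Set.range_comp] at h
  refine Submodule.span_mono ?_ h
  rintro _ ⟨e, rfl⟩
  let extend : Fin n → R × R := fun i => if hi : i ∈ S then e ⟨i, hi⟩ else 0
  have extend_eq_zero (i) (hi : i ∉ S) : extend i = 0 := dif_neg hi
  have restrict_extend : (fun i : S => extend i) = e := funext fun i => dif_pos i.2
  refine ⟨extend, extend_eq_zero, ?_⟩
  rw [← localOperator_weyl S extend_eq_zero, restrict_extend]
  rfl

end LocalOperator

section Projection

variable {𝕜 X : Type*} [RCLike 𝕜] [Fintype X] {P : Matrix X X 𝕜}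

theorem eigenvalues_eq_zero_or_one [DecidableEq X] (hP : P.IsHermitian) (hPP : IsIdempotentElem P)
    (i : X) : hP.eigenvalues i = 0 ∨ hP.eigenvalues i = 1 :=
  hPP.spectrum_subset ℝ (hP.eigenvalues_mem_spectrum_real i)

theorem trace_eq_card_eigenvalues_eq_one [DecidableEq X] (hP : P.IsHermitian)
    (hPP : IsIdempotentElem P) : P.trace = Fintype.card {i // hP.eigenvalues i = 1} := by
  rw [hP.trace_eq_sum_eigenvalues, Fintype.card_subtype, ← Finset.sum_boole]
  refine Finset.sum_congr rfl fun i _ => ?_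
  rcases eigenvalues_eq_zero_or_one hP hPP i with h | h <;> simp [h]

theorem exists_isometry_of_isIdempotentElem {Y : Type*} [Fintype Y] [DecidableEq Y]
    (hP : P.IsHermitian) (hPP : IsIdempotentElem P) (htr : P.trace = Fintype.card Y) :
    ∃ J : Matrix X Y 𝕜, Jᴴ * J = 1 ∧ J * Jᴴ = P := by
  classical
  let U : Matrix X X 𝕜 := hP.eigenvectorUnitary
  have conjTranspose_mul_self : Uᴴ * U = 1 := Unitary.coe_star_mul_self hP.eigenvectorUnitary
  have spectral : P = U * Matrix.diagonal (RCLike.ofReal ∘ hP.eigenvalues) * Uᴴ :=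
    hP.spectral_theorem.trans (Unitary.conjStarAlgAut_apply _ _)
  have card_eq : Fintype.card Y = Fintype.card {i // hP.eigenvalues i = 1} := by
    exact_mod_cast htr.symm.trans (trace_eq_card_eigenvalues_eq_one hP hPP)
  let τ : Y ≃ {i // hP.eigenvalues i = 1} := Fintype.equivOfCardEq card_eq
  refine ⟨U.submatrix id fun y => τ y, ?_, ?_⟩
  · have h := congr(Matrix.submatrix $conjTranspose_mul_self (fun y => (τ y : X)) fun y => τ y)
    rw [Matrix.submatrix_mul _ _ _ id _ Function.bijective_id] at h
    exact h.trans (Matrix.submatrix_one _ (Subtype.val_injective.comp τ.injective))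
  · ext x x'
    conv_rhs => rw [spectral]
    rw [Matrix.mul_apply, Matrix.mul_apply]
    simp only [Matrix.conjTranspose_apply, Matrix.submatrix_apply, id, Matrix.mul_diagonal,
      Function.comp_apply]
    rw [Equiv.sum_comp τ fun i => U x i * star (U x' i),
      ← Finset.sum_subtype (Finset.univ.filter fun i => hP.eigenvalues i = 1) (by simp)
        fun i => U x i * star (U x' i), Finset.sum_filter]
    refine Finset.sum_congr rfl fun i _ => ?_
    rcases eigenvalues_eq_zero_or_one hP hPP i with h | h <;> simp [h]

end Projection

section Isotropic

open Module

theorem exists_maximal_isotropic {R V : Type*} [CommRing R] [AddCommGroup V] [Module R V]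
    [IsNoetherian R V] {B : LinearMap.BilinForm R V} (hB : B.IsAlt) (D : Submodule R V) :
    ∃ I ≤ D, I ≤ B.orthogonal I ∧ D ⊓ B.orthogonal I ≤ I := by
  obtain ⟨I, ⟨hID, hII⟩, hmax⟩ := set_has_maximal_iff_noetherian.2 ‹IsNoetherian R V›
    {I | I ≤ D ∧ I ≤ B.orthogonal I} ⟨⊥, bot_le, bot_le⟩
  refine ⟨I, hID, hII, fun x ⟨hxD, hxI⟩ => ?_⟩
  have isotropic_sup : I ⊔ R ∙ x ≤ B.orthogonal (I ⊔ R ∙ x) := by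
    intro v hv w hw
    obtain ⟨v₁, hv₁, v₂, hv₂, rfl⟩ := Submodule.mem_sup.1 hv
    obtain ⟨w₁, hw₁, w₂, hw₂, rfl⟩ := Submodule.mem_sup.1 hw
    obtain ⟨a, rfl⟩ := Submodule.mem_span_singleton.1 hv₂
    obtain ⟨b, rfl⟩ := Submodule.mem_span_singleton.1 hw₂
    have w₁_v₁ : B w₁ v₁ = 0 := hII hv₁ w₁ hw₁
    have w₁_x : B w₁ x = 0 := hxI w₁ hw₁
    have x_v₁ : B x v₁ = 0 := hB.isRefl _ _ (hxI v₁ hv₁)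
    simp [w₁_v₁, w₁_x, x_v₁, hB x]
  have le_D : I ⊔ R ∙ x ≤ D := sup_le hID ((Submodule.span_singleton_le_iff_mem _ _).2 hxD)
  rw [eq_of_le_of_not_lt le_sup_left (hmax (I ⊔ R ∙ x) ⟨le_D, isotropic_sup⟩)]
  exact Submodule.mem_sup_right (Submodule.mem_span_singleton_self x)

variable {L V : Type*} [Field L] [AddCommGroup V] [Module L V] [FiniteDimensional L V]
  {B : LinearMap.BilinForm L V}

theorem two_mul_finrank_of_maximal_isotropic (hB : B.Nondegenerate) (hr : B.IsRefl)
    {D I : Submodule L V} (hID : I ≤ D) (hII : I ≤ B.orthogonal I) (hI : D ⊓ B.orthogonal I ≤ I) :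
    2 * finrank L I = finrank L D + finrank L (D ⊓ B.orthogonal D : Submodule L V) := by
  have inf_orthogonal : I ⊓ B.orthogonal D = D ⊓ B.orthogonal D :=
    le_antisymm (inf_le_inf_right _ hID) <| le_inf
      ((inf_le_inf_left D (LinearMap.BilinForm.orthogonal_le hID)).trans hI) inf_le_right
  have orthogonal_sup : B.orthogonal (I ⊔ B.orthogonal D) = I := by
    apply le_antisymm
    · refine le_trans (le_inf ?_ (LinearMap.BilinForm.orthogonal_le le_sup_left)) hI
      exact (LinearMap.BilinForm.orthogonal_le le_sup_right).trans
        (LinearMap.BilinForm.orthogonal_orthogonal hB hr D).le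
    · intro x hx y hy
      obtain ⟨y₁, hy₁, y₂, hy₂, rfl⟩ := Submodule.mem_sup.1 hy
      have y₁_x : B y₁ x = 0 := hII hx y₁ hy₁
      have y₂_x : B y₂ x = 0 := hr _ _ (hy₂ x (hID hx))
      simp [y₁_x, y₂_x]
  have finrank_orthogonal_sup := LinearMap.BilinForm.finrank_orthogonal hB (I ⊔ B.orthogonal D)
  have finrank_orthogonal := LinearMap.BilinForm.finrank_orthogonal hB D
  have finrank_sup_inf := Submodule.finrank_sup_add_finrank_inf_eq I (B.orthogonal D)
  have finrank_sup_le := Submodule.finrank_le (I ⊔ B.orthogonal D)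
  have finrank_le := Submodule.finrank_le D
  rw [orthogonal_sup] at finrank_orthogonal_sup
  rw [inf_orthogonal] at finrank_sup_inf
  omega

theorem exists_isotropic_sup_range_eq (hB : B.Nondegenerate) (hB' : B.IsAlt) {c : ℕ}
    {D : Submodule L V}
    (hD : finrank L (D ⊓ B.orthogonal D : Submodule L V) + 2 * c = finrank L D) :
    ∃ (I : Submodule L V) (β : (Fin c → L) →ₗ[L] V), I ≤ B.orthogonal I ∧
      I ⊔ LinearMap.range β = D ∧ (∀ b, β b ∈ B.orthogonal I → b = 0) ∧
      finrank L I + c = finrank L D := by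
  obtain ⟨I, hID, hII, hI⟩ := exists_maximal_isotropic hB' D
  have two_mul_finrank := two_mul_finrank_of_maximal_isotropic hB hB'.isRefl hID hII hI
  obtain ⟨K, hIK⟩ := exists_isCompl (I.submoduleOf D)
  have finrank_compl := Submodule.finrank_add_eq_of_isCompl hIK
  rw [(Submodule.submoduleOfEquivOfLe hID).finrank_eq] at finrank_compl
  let b := finBasisOfFinrankEq L K (n := c) (by omega)
  refine ⟨I, D.subtype ∘ₗ K.subtype ∘ₗ b.equivFun.symm.toLinearMap, hII, ?_, ?_, by omega⟩
  · rw [LinearMap.range_comp, LinearMap.range_comp, LinearEquiv.range, Submodule.map_top,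
      Submodule.range_subtype]
    have h := congrArg (Submodule.map D.subtype) hIK.sup_eq_top
    rwa [Submodule.map_sup, Submodule.map_top, Submodule.range_subtype, Submodule.submoduleOf,
      Submodule.map_comap_subtype, inf_eq_right.2 hID] at h
  · intro a ha
    have mem_I := hI ⟨(b.equivFun.symm a : D).2, ha⟩
    have eq_zero := Submodule.disjoint_def.1 hIK.disjoint _ mem_I (b.equivFun.symm a).2
    exact b.equivFun.symm.map_eq_zero_iff.1 (Subtype.ext eq_zero)

end Isotropic

/-! ### Stabilizer codes with shared pairs -/

section StabilizerProjection

variable {R ι : Type*} [CommRing R] [Fintype R] [DecidableEq R] [Fintype ι] [DecidableEq ι]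
  (χ : AddChar R ℂ)

open Classical in
/-- The average of the Weyl operators of the elements of `I`. For isotropic `I` it is the
orthogonal projection onto the joint fixed space of these operators, which generate the stabilizer
group of the code that is constructed below. -/
noncomputable def stabilizerProj (I : Submodule R (ι → R × R)) : Matrix (ι → R) (ι → R) ℂ :=
  (Fintype.card I : ℂ)⁻¹ • ∑ e : I, weyl χ (e : ι → R × R)

variable {χ} {I : Submodule R (ι → R × R)}

theorem conjTranspose_stabilizerProj : (stabilizerProj χ I)ᴴ = stabilizerProj χ I := by
  classical
  rw [stabilizerProj, Matrix.conjTranspose_smul, Matrix.conjTranspose_sum, star_inv₀,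
    star_natCast, ← Equiv.sum_comp (Equiv.neg I)]
  simp [conjTranspose_weyl]

theorem weyl_mul_stabilizerProj (hI : I ≤ (symplecticForm R ι).orthogonal I)
    {e : ι → R × R} (he : e ∈ I) : weyl χ e * stabilizerProj χ I = stabilizerProj χ I := by
  classical
  rw [stabilizerProj, Matrix.mul_smul, Finset.mul_sum,
    ← Equiv.sum_comp (Equiv.addLeft (⟨e, he⟩ : I)) fun f : I => weyl χ (f : ι → R × R)]
  refine congrArg _ (Finset.sum_congr rfl fun f _ => ?_)
  have isOrtho : symplecticForm R ι e f = 0 := hI f.2 e he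
  rw [weyl_mul, isOrtho, AddChar.map_zero_eq_one, one_smul]
  rfl

theorem stabilizerProj_mul_weyl (hI : I ≤ (symplecticForm R ι).orthogonal I)
    {e : ι → R × R} (he : e ∈ I) : stabilizerProj χ I * weyl χ e = stabilizerProj χ I := by
  have h := congrArg Matrix.conjTranspose (weyl_mul_stabilizerProj (χ := χ) hI (I.neg_mem he))
  rwa [Matrix.conjTranspose_mul, conjTranspose_stabilizerProj, conjTranspose_weyl, neg_neg] at h

theorem isIdempotentElem_stabilizerProj (hI : I ≤ (symplecticForm R ι).orthogonal I) :
    IsIdempotentElem (stabilizerProj χ I) := by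
  classical
  unfold IsIdempotentElem
  conv_lhs => enter [1]; rw [stabilizerProj]
  rw [Matrix.smul_mul, Finset.sum_mul,
    Finset.sum_congr rfl fun e _ => weyl_mul_stabilizerProj hI e.2, Finset.sum_const,
    Finset.card_univ, ← Nat.cast_smul_eq_nsmul ℂ, smul_smul,
    inv_mul_cancel₀ (Nat.cast_ne_zero.2 Fintype.card_ne_zero), one_smul]

theorem trace_weyl_mul_stabilizerProj (hχ : χ.IsPrimitive) (h2 : IsUnit (2 : R)) {e : ι → R × R}
    (he : e ∉ I) : (weyl χ e * stabilizerProj χ I).trace = 0 := by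
  classical
  rw [stabilizerProj, Matrix.mul_smul, Finset.mul_sum, Matrix.trace_smul, Matrix.trace_sum,
    Finset.sum_eq_zero, smul_zero]
  intro f _
  have add_ne_zero : e + f ≠ 0 := fun h => he (eq_neg_of_add_eq_zero_left h ▸ I.neg_mem f.2)
  rw [weyl_mul, Matrix.trace_smul, trace_weyl hχ h2 add_ne_zero, smul_zero]

open Classical in
theorem trace_stabilizerProj (hχ : χ.IsPrimitive) (h2 : IsUnit (2 : R)) :
    (stabilizerProj χ I).trace = (Fintype.card I : ℂ)⁻¹ * Fintype.card (ι → R) := by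
  rw [stabilizerProj, Matrix.trace_smul, Matrix.trace_sum, Finset.sum_eq_single_of_mem 0
    (Finset.mem_univ _) fun f _ hf => trace_weyl hχ h2 fun h => hf (Subtype.ext h),
    Submodule.coe_zero, weyl_zero, Matrix.trace_one, smul_eq_mul]

theorem weyl_mul_stabilizerProj_comm {e : ι → R × R}
    (he : e ∈ (symplecticForm R ι).orthogonal I) :
    weyl χ e * stabilizerProj χ I = stabilizerProj χ I * weyl χ e := by
  classical
  rw [stabilizerProj, Matrix.mul_smul, Finset.mul_sum, Matrix.smul_mul, Finset.sum_mul]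
  refine congrArg _ (Finset.sum_congr rfl fun f _ => ?_)
  have isOrtho : symplecticForm R ι f e = 0 := he f f.2
  rw [weyl_mul_comm χ e, symplecticForm_swap, isOrtho, neg_zero, mul_zero,
    AddChar.map_zero_eq_one, one_smul]

theorem stabilizerProj_mul_weyl_mul_stabilizerProj (hχ : χ.IsPrimitive) (h2 : IsUnit (2 : R))
    (hI : I ≤ (symplecticForm R ι).orthogonal I) {f : ι → R × R}
    (hf : f ∉ (symplecticForm R ι).orthogonal I) :
    stabilizerProj χ I * weyl χ f * stabilizerProj χ I = 0 := by
  obtain ⟨e, he, hef⟩ : ∃ e ∈ I, symplecticForm R ι e f ≠ 0 := by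
    simpa [LinearMap.BilinForm.mem_orthogonal_iff] using hf
  obtain ⟨a, ha⟩ := exists_addChar_two_mul_ne_one hχ h2 hef
  have hae : a • e ∈ I := I.smul_mem a he
  set P := stabilizerProj χ I with hP
  have phase_smul : χ (2 * (a * symplecticForm R ι e f)) • (P * weyl χ f * P) =
      P * weyl χ f * P := by
    calc _ = χ (2 * (a * symplecticForm R ι e f)) • (P * weyl χ f * (weyl χ (a • e) * P)) := by
          rw [hP, weyl_mul_stabilizerProj hI hae]
      _ = P * (weyl χ (a • e) * weyl χ f) * P := by
          rw [weyl_mul_comm, map_smul, LinearMap.smul_apply, smul_eq_mul, Matrix.mul_smul,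
            Matrix.smul_mul]
          simp only [Matrix.mul_assoc]
      _ = P * weyl χ f * P := by
          rw [← Matrix.mul_assoc P, hP, stabilizerProj_mul_weyl hI hae]
  by_contra h0
  exact ha (smul_left_injective ℂ h0 (phase_smul.trans (one_smul ℂ _).symm))

variable {Y : Type*} [Fintype Y] [DecidableEq Y] {J : Matrix (ι → R) Y ℂ}

theorem conjTranspose_mul_weyl_mul_eq_zero (hχ : χ.IsPrimitive) (h2 : IsUnit (2 : R))
    (hI : I ≤ (symplecticForm R ι).orthogonal I) (hJ : Jᴴ * J = 1)
    (hJI : J * Jᴴ = stabilizerProj χ I) {f : ι → R × R}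
    (hf : f ∉ (symplecticForm R ι).orthogonal I) : Jᴴ * weyl χ f * J = 0 := by
  calc Jᴴ * weyl χ f * J = (Jᴴ * J) * Jᴴ * weyl χ f * J * (Jᴴ * J) := by simp [hJ]
    _ = Jᴴ * ((J * Jᴴ) * weyl χ f * (J * Jᴴ)) * J := by simp only [Matrix.mul_assoc]
    _ = 0 := by
      rw [hJI, stabilizerProj_mul_weyl_mul_stabilizerProj hχ h2 hI hf, Matrix.mul_zero,
        Matrix.zero_mul]

theorem conjTranspose_mul_weyl_mul_notMem_span_one [Nonempty Y] (hχ : χ.IsPrimitive)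
    (h2 : IsUnit (2 : R)) (hI : I ≤ (symplecticForm R ι).orthogonal I) (hJ : Jᴴ * J = 1)
    (hJI : J * Jᴴ = stabilizerProj χ I) {e : ι → R × R}
    (he : e ∈ (symplecticForm R ι).orthogonal I) (heI : e ∉ I) :
    Jᴴ * weyl χ e * J ∉ ℂ ∙ (1 : Matrix Y Y ℂ) := by
  intro h
  obtain ⟨z, hz⟩ := Submodule.mem_span_singleton.1 h
  have trace_eq_zero : (z • (1 : Matrix Y Y ℂ)).trace = 0 := by
    rw [hz, Matrix.mul_assoc, Matrix.trace_mul_comm, Matrix.mul_assoc, hJI,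
      trace_weyl_mul_stabilizerProj hχ h2 heI]
  have z_eq_zero : z = 0 := by
    simpa [Matrix.trace_smul] using trace_eq_zero
  have weyl_mul_proj : weyl χ e * stabilizerProj χ I = 0 := by
    rw [← isIdempotentElem_stabilizerProj hI, ← Matrix.mul_assoc, weyl_mul_stabilizerProj_comm he,
      ← hJI]
    calc J * Jᴴ * weyl χ e * (J * Jᴴ) = J * (Jᴴ * weyl χ e * J) * Jᴴ := by
          simp only [Matrix.mul_assoc]
      _ = 0 := by rw [← hz, z_eq_zero, zero_smul, Matrix.mul_zero, Matrix.zero_mul]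
  have proj_eq_zero : J * Jᴴ = 0 := by
    rw [← Matrix.one_mul (J * Jᴴ), ← weyl_neg_mul_self χ e, Matrix.mul_assoc, hJI, weyl_mul_proj,
      Matrix.mul_zero]
  refine one_ne_zero (α := Matrix Y Y ℂ) ?_
  calc (1 : Matrix Y Y ℂ) = Jᴴ * (J * Jᴴ) * J := by
        rw [← Matrix.mul_assoc, hJ, Matrix.one_mul, hJ]
    _ = 0 := by rw [proj_eq_zero, Matrix.mul_zero, Matrix.zero_mul]

end StabilizerProjection

section MutualOrthogonality

variable {L : Type*} [Field L] {n c : ℕ} {I : Submodule L (Fin n → L × L)}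
  {β : (Fin c → L) →ₗ[L] Fin n → L × L}

theorem mem_orthogonal_sup_range_iff {e : Fin n → L × L} :
    e ∈ (symplecticForm L (Fin n)).orthogonal (I ⊔ LinearMap.range β) ↔
      e ∈ (symplecticForm L (Fin n)).orthogonal I ∧
        ∀ b, symplecticForm L (Fin n) e (β b) = 0 := by
  simp only [LinearMap.BilinForm.mem_orthogonal_iff]
  refine ⟨fun h => ⟨fun f hf => h f (Submodule.mem_sup_left hf), fun b => ?_⟩, fun h f hf => ?_⟩
  · rw [symplecticForm_swap, h _ (Submodule.mem_sup_right ⟨b, rfl⟩), neg_zero]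
  · obtain ⟨g, hg, _, ⟨b, rfl⟩, rfl⟩ := Submodule.mem_sup.1 hf
    rw [map_add, LinearMap.add_apply, h.1 g hg, symplecticForm_swap e, h.2 b, neg_zero, add_zero]

theorem sum_addChar_symplecticForm_eq_zero [Fintype L] {χ : AddChar L ℂ}
    (hχ : χ.IsPrimitive) (h2 : (2 : L) ≠ 0)
    {e : Fin n → L × L} (he : ∃ b, symplecticForm L (Fin n) e (β b) ≠ 0) :
    ∑ b, χ (2 * symplecticForm L (Fin n) e (β b)) = 0 := by
  obtain ⟨b, hb⟩ := he
  obtain ⟨a, ha⟩ := exists_addChar_two_mul_ne_one hχ h2.isUnit hb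
  let ψ : AddChar (Fin c → L) ℂ := χ.compAddMonoidHom
    (((2 : L) • (symplecticForm L (Fin n) e).comp β).toAddMonoidHom)
  have ψ_ne_zero : ψ ≠ 0 := AddChar.ne_one_iff.2 ⟨a • b, by simpa [ψ, mul_left_comm] using ha⟩
  exact AddChar.sum_eq_zero_iff_ne_zero.2 ψ_ne_zero

end MutualOrthogonality

section StabilizerCode

variable {L : Type*} [Field L] [Fintype L] [DecidableEq L] {n k c : ℕ} {χ : AddChar L ℂ}
  {I : Submodule L (Fin n → L × L)} {β : (Fin c → L) →ₗ[L] Fin n → L × L}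
  {J : Matrix (Fin n → L) (Fin k → L) ℂ}

theorem exists_isometry_onto_stabilizer (hχ : χ.IsPrimitive) (h2 : (2 : L) ≠ 0)
    (hI : I ≤ (symplecticForm L (Fin n)).orthogonal I) (hk : Module.finrank L I + k = n) :
    ∃ J : Matrix (Fin n → L) (Fin k → L) ℂ, Jᴴ * J = 1 ∧ J * Jᴴ = stabilizerProj χ I := by
  classical
  refine exists_isometry_of_isIdempotentElem conjTranspose_stabilizerProj
    (isIdempotentElem_stabilizerProj hI) ?_
  rw [trace_stabilizerProj hχ h2.isUnit, Module.card_eq_pow_finrank (K := L) (V := I),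
    Fintype.card_fun, Fintype.card_fun, Fintype.card_fin, Fintype.card_fin, Nat.cast_pow,
    Nat.cast_pow, Nat.cast_pow, inv_mul_eq_iff_eq_mul₀ (by simp), ← pow_add, hk]

/-- The entanglement-assisted code whose pairs, in the basis state `b`, displace the image of the
isometry `J` by the Weyl operator of `β b`; the hypothesis `hβ` says that the displaced images are
pairwise orthogonal. -/
def stabilizerCode (β : (Fin c → L) →ₗ[L] Fin n → L × L) (hJ : Jᴴ * J = 1)
    (hβ : ∀ b, b ≠ 0 → Jᴴ * weyl χ (β b) * J = 0) : EAQECC L n k c where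
  encoder := Matrix.of fun x p => (weyl χ (β p.2) * J) x p.1
  isometry := by
    ext ⟨u, b⟩ ⟨u', b'⟩
    trans ((weyl χ (β b) * J)ᴴ * (weyl χ (β b') * J)) u u'
    · simp only [Matrix.mul_apply, Matrix.conjTranspose_apply, Matrix.of_apply]
    · rw [Matrix.conjTranspose_mul, conjTranspose_weyl, Matrix.mul_assoc,
        ← Matrix.mul_assoc (weyl χ _), weyl_mul, neg_add_eq_sub, ← map_sub, Matrix.smul_mul,
        Matrix.mul_smul, ← Matrix.mul_assoc]
      by_cases hb : b = b'
      · subst hb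
        simp [weyl_zero, hJ, Matrix.one_apply, symplecticForm_isAlt (β b)]
      · rw [hβ _ (sub_ne_zero.2 (Ne.symm hb)), smul_zero, Matrix.one_apply_ne (by simp [hb])]
        rfl

theorem compression_stabilizerCode_weyl (hJ : Jᴴ * J = 1)
    (hβ : ∀ b, b ≠ 0 → Jᴴ * weyl χ (β b) * J = 0) (e : Fin n → L × L) :
    (stabilizerCode β hJ hβ).compression (weyl χ e) =
      (∑ b, χ (2 * symplecticForm L (Fin n) e (β b))) • (Jᴴ * weyl χ e * J) := by
  rw [EAQECC.compression_apply, Finset.sum_smul]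
  refine Finset.sum_congr rfl fun b _ => ?_
  have block_eq : (stabilizerCode β hJ hβ).block b = weyl χ (β b) * J := rfl
  calc _ = Jᴴ * (weyl χ (-β b) * weyl χ e * weyl χ (β b)) * J := by
        rw [block_eq, Matrix.conjTranspose_mul, conjTranspose_weyl]
        simp only [Matrix.mul_assoc]
    _ = _ := by rw [weyl_neg_mul_mul, Matrix.mul_smul, Matrix.smul_mul]

theorem detects_stabilizerCode_weyl (hχ : χ.IsPrimitive) (h2 : (2 : L) ≠ 0)
    (hI : I ≤ (symplecticForm L (Fin n)).orthogonal I) (hJ : Jᴴ * J = 1)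
    (hJI : J * Jᴴ = stabilizerProj χ I) (hβ : ∀ b, b ≠ 0 → Jᴴ * weyl χ (β b) * J = 0)
    {e : Fin n → L × L}
    (he : e ∉ (symplecticForm L (Fin n)).orthogonal (I ⊔ LinearMap.range β)) :
    (stabilizerCode β hJ hβ).Detects (weyl χ e) := by
  rw [EAQECC.detects_iff, compression_stabilizerCode_weyl]
  rw [mem_orthogonal_sup_range_iff, not_and_or, not_forall] at he
  rcases he with he | he
  · rw [conjTranspose_mul_weyl_mul_eq_zero hχ h2.isUnit hI hJ hJI he, smul_zero]
    exact Submodule.zero_mem _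
  · rw [sum_addChar_symplecticForm_eq_zero hχ h2 he, zero_smul]
    exact Submodule.zero_mem _

theorem not_detects_stabilizerCode_weyl (hχ : χ.IsPrimitive) (h2 : (2 : L) ≠ 0)
    (hI : I ≤ (symplecticForm L (Fin n)).orthogonal I) (hJ : Jᴴ * J = 1)
    (hJI : J * Jᴴ = stabilizerProj χ I) (hβ : ∀ b, b ≠ 0 → Jᴴ * weyl χ (β b) * J = 0)
    {e : Fin n → L × L}
    (he : e ∈ (symplecticForm L (Fin n)).orthogonal (I ⊔ LinearMap.range β)) (heI : e ∉ I) :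
    ¬ (stabilizerCode β hJ hβ).Detects (weyl χ e) := by
  obtain ⟨he, heβ⟩ := mem_orthogonal_sup_range_iff.1 he
  have sum_eq : ∑ b, χ (2 * symplecticForm L (Fin n) e (β b)) = Fintype.card (Fin c → L) := by
    simp [heβ]
  rw [EAQECC.detects_iff, compression_stabilizerCode_weyl, sum_eq,
    Submodule.smul_mem_iff _ (Nat.cast_ne_zero.2 Fintype.card_ne_zero)]
  exact conjTranspose_mul_weyl_mul_notMem_span_one hχ h2.isUnit hI hJ hJI he heI

theorem exists_eaqecc_hasMinDist {d : ℕ} (h2 : (2 : L) ≠ 0) (D : Submodule L (Fin n → L × L))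
    (hdim : Module.finrank L D + k = n + c)
    (hrad : Module.finrank L (D ⊓ (symplecticForm L (Fin n)).orthogonal D : Submodule L _) +
      2 * c = Module.finrank L D)
    (hd : ∀ e ∈ (symplecticForm L (Fin n)).orthogonal D, e ≠ 0 → d ≤ hammingNorm e)
    (hd' : ∃ e ∈ (symplecticForm L (Fin n)).orthogonal D, e ∉ D ∧ hammingNorm e = d) :
    ∃ Q : EAQECC L n k c, Q.HasMinDist d := by
  let χ : AddChar L ℂ := AddChar.FiniteField.primitiveChar_to_Complex L
  have hχ : χ.IsPrimitive := AddChar.FiniteField.primitiveChar_to_Complex_isPrimitive L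
  obtain ⟨I, β, hI, rfl, hβ, finrank_eq⟩ :=
    exists_isotropic_sup_range_eq symplecticForm_nondegenerate symplecticForm_isAlt hrad
  obtain ⟨J, hJ, hJI⟩ := exists_isometry_onto_stabilizer (k := k) hχ h2 hI (by omega)
  have displaced_orthogonal (b) (hb : b ≠ 0) : Jᴴ * weyl χ (β b) * J = 0 :=
    conjTranspose_mul_weyl_mul_eq_zero hχ h2.isUnit hI hJ hJI fun h => hb (hβ b h)
  refine ⟨stabilizerCode β hJ displaced_orthogonal, fun S E hS hE => ?_, ?_⟩
  · refine EAQECC.Detects.of_mem_span ?_ (hE.mem_span_weyl hχ h2.isUnit)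
    rintro _ ⟨e, he, rfl⟩
    by_cases heD : e ∈ (symplecticForm L (Fin n)).orthogonal (I ⊔ LinearMap.range β)
    · have hammingNorm_le : hammingNorm e ≤ S.card := Finset.card_le_card fun i hi =>
        not_imp_comm.1 (he i) (Finset.mem_filter.1 hi).2
      have e_eq_zero : e = 0 := by
        by_contra he0
        exact (hd e heD he0).not_gt (hammingNorm_le.trans_lt hS)
      rw [EAQECC.detects_iff, e_eq_zero, weyl_zero, EAQECC.compression_one]
      exact Submodule.smul_mem _ _ (Submodule.mem_span_singleton_self 1)
    · exact detects_stabilizerCode_weyl hχ h2 hI hJ hJI displaced_orthogonal heD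
  · obtain ⟨e, heD, heD', hwt⟩ := hd'
    exact ⟨Finset.univ.filter fun i => e i ≠ 0, weyl χ e, hwt, actsOn_weyl (by simp),
      not_detects_stabilizerCode_weyl hχ h2 hI hJ hJI displaced_orthogonal heD
        fun heI => heD' (Submodule.mem_sup_left heI)⟩

end StabilizerCode

section HermitianDual

variable {F : Type*} [Field F] {n m : ℕ} {σ : F →+* F}

/-- The dual code with respect to the form `∑ i, v i * σ (w i)`, which is Hermitian for an
involution `σ`. -/
def hermitianDual (σ : F →+* F) (W : Submodule F (Fin n → F)) : Submodule F (Fin n → F) where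
  carrier := {v | ∀ w ∈ W, v ⬝ᵥ (σ ∘ w) = 0}
  add_mem' hu hv w hw := by rw [add_dotProduct, hu w hw, hv w hw, add_zero]
  zero_mem' _ _ := zero_dotProduct _
  smul_mem' a v hv w hw := by rw [smul_dotProduct, hv w hw, smul_zero]

theorem mem_hermitianDual {W : Submodule F (Fin n → F)} {v : Fin n → F} :
    v ∈ hermitianDual σ W ↔ ∀ w ∈ W, v ⬝ᵥ (σ ∘ w) = 0 := Iff.rfl

theorem hermitianDual_range (hσ : Function.Involutive σ) (H : Matrix (Fin m) (Fin n) F) :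
    hermitianDual σ (LinearMap.range (H.map σ)ᵀ.mulVecLin) = LinearMap.ker H.mulVecLin := by
  have dotProduct_eq (v : Fin n → F) (y : Fin m → F) :
      v ⬝ᵥ (σ ∘ ((H.map σ)ᵀ *ᵥ y)) = (H *ᵥ v) ⬝ᵥ (σ ∘ y) := by
    have map_map : (H.map σ)ᵀ.map σ = Hᵀ := by
      ext i j
      exact hσ _
    have map_mulVec : σ ∘ ((H.map σ)ᵀ *ᵥ y) = Hᵀ *ᵥ (σ ∘ y) :=
      funext fun i => by rw [Function.comp_apply, RingHom.map_mulVec, map_map]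
    rw [map_mulVec, Matrix.dotProduct_mulVec, Matrix.vecMul_transpose]
  ext v
  rw [mem_hermitianDual, LinearMap.mem_ker, Matrix.mulVecLin_apply]
  refine ⟨fun h => dotProduct_eq_zero _ fun y => ?_, fun h w ⟨y, hy⟩ => ?_⟩
  · have comp_comp : σ ∘ σ ∘ y = y := funext fun i => hσ (y i)
    rw [← comp_comp, ← dotProduct_eq]
    exact h _ ⟨_, rfl⟩
  · rw [← hy, Matrix.mulVecLin_apply, dotProduct_eq, h, zero_dotProduct]

end HermitianDual

section ParityCheck

variable {F : Type*} [Field F] {m n : ℕ} {C : Submodule F (Fin n → F)}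

theorem finrank_range_inf_ker_add_finrank_range_comp {U V W : Type*} [AddCommGroup U] [Module F U]
    [FiniteDimensional F U] [AddCommGroup V] [Module F V] [AddCommGroup W] [Module F W]
    {g : U →ₗ[F] V} (hg : Function.Injective g) (h : V →ₗ[F] W) :
    Module.finrank F (LinearMap.range g ⊓ LinearMap.ker h : Submodule F V) +
      Module.finrank F (LinearMap.range (h ∘ₗ g)) = Module.finrank F U := by
  rw [← Submodule.map_comap_eq, ← LinearMap.ker_comp, add_comm,
    LinearEquiv.finrank_eq (Submodule.equivMapOfInjective g hg _).symm,
    LinearMap.finrank_range_add_finrank_ker]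

theorem IsParityCheck.ker_mulVecLin {H : Matrix (Fin m) (Fin n) F} (hH : IsParityCheck C H) :
    LinearMap.ker H.mulVecLin = C :=
  Submodule.ext fun v => (hH.2 v).symm

theorem IsParityCheck.exists_mul_eq_one {H : Matrix (Fin m) (Fin n) F} (hH : IsParityCheck C H) :
    ∃ R : Matrix (Fin n) (Fin m) F, H * R = 1 := by
  have finrank_range := LinearMap.finrank_range_add_finrank_ker H.mulVecLin
  rw [hH.ker_mulVecLin, Module.finrank_fin_fun] at finrank_range
  have range_eq_top : LinearMap.range H.mulVecLin = ⊤ := Submodule.eq_top_of_finrank_eq <| by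
    rw [Module.finrank_fin_fun]
    have := hH.1
    omega
  exact Matrix.mulVec_surjective_iff_exists_right_inverse.1 (LinearMap.range_eq_top.1 range_eq_top)

theorem exists_isParityCheck (h : Module.finrank F C + m = n) :
    ∃ H : Matrix (Fin m) (Fin n) F, IsParityCheck C H := by
  have finrank_quotient := Submodule.finrank_quotient_add_finrank C
  rw [Module.finrank_fin_fun] at finrank_quotient
  let e : ((Fin n → F) ⧸ C) ≃ₗ[F] (Fin m → F) :=
    LinearEquiv.ofFinrankEq _ _ (by rw [Module.finrank_fin_fun]; omega)
  refine ⟨LinearMap.toMatrix' (e.toLinearMap ∘ₗ C.mkQ), h, fun v => ?_⟩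
  rw [LinearMap.toMatrix'_mulVec]
  simp

theorem IsParityCheck.injective_mulVecLin_transpose_map {H : Matrix (Fin m) (Fin n) F}
    (hH : IsParityCheck C H) (σ : F →+* F) : Function.Injective (H.map σ)ᵀ.mulVecLin := by
  obtain ⟨R, hR⟩ := hH.exists_mul_eq_one
  have left_inverse : (R.map σ)ᵀ * (H.map σ)ᵀ = 1 := by
    rw [← Matrix.transpose_mul, ← Matrix.map_mul, hR, Matrix.map_one σ σ.map_zero σ.map_one,
      Matrix.transpose_one]
  exact Function.LeftInverse.injective (g := ((R.map σ)ᵀ).mulVecLin) fun v => by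
    simp only [Matrix.mulVecLin_apply, Matrix.mulVec_mulVec, left_inverse, Matrix.one_mulVec]

end ParityCheck

section HermitianConstruction

variable {L F : Type*} [Field L] [Field F] [Algebra L F] {n : ℕ} {σ : F →ₐ[L] F} {β : F}

theorem injective_coprod_toSpanSingleton (hβ : σ β ≠ β) : Function.Injective
    ((Algebra.linearMap L F).coprod (LinearMap.toSpanSingleton L F β)) := by
  rw [← LinearMap.ker_eq_bot, LinearMap.ker_eq_bot']
  rintro ⟨a, b⟩ hab
  have combination : algebraMap L F a + b • β = 0 := by simpa using hab
  have b_smul : b • (σ β - β) = 0 := by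
    have conjugate := congrArg σ combination
    rw [map_add, map_smul, AlgHom.commutes, map_zero, ← combination] at conjugate
    rw [smul_sub, sub_eq_zero, add_left_cancel conjugate]
  obtain rfl : b = 0 := (smul_eq_zero.1 b_smul).resolve_right (sub_ne_zero.2 hβ)
  simpa using combination

/-- The coordinates of the words over a quadratic extension with respect to the basis `1, β`, where
`β` is moved by some automorphism `σ`. -/
noncomputable def quadraticCoordinates (n : ℕ) (hLF : Module.finrank L F = 2) (hβ : σ β ≠ β) :
    (Fin n → L × L) ≃ₗ[L] (Fin n → F) :=
  have : FiniteDimensional L F := Module.finite_of_finrank_pos (by omega)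
  LinearEquiv.piCongrRight fun _ =>
    LinearEquiv.ofInjectiveOfFinrankEq _ (injective_coprod_toSpanSingleton hβ) (by simp [hLF])

theorem quadraticCoordinates_apply (hLF : Module.finrank L F = 2) (hβ : σ β ≠ β)
    (e : Fin n → L × L) (i : Fin n) :
    quadraticCoordinates n hLF hβ e i = algebraMap L F (e i).1 + algebraMap L F (e i).2 * β := by
  simp [quadraticCoordinates, LinearEquiv.ofInjectiveOfFinrankEq, Algebra.smul_def]

theorem hammingNorm_quadraticCoordinates [DecidableEq L] [DecidableEq F]
    (hLF : Module.finrank L F = 2) (hβ : σ β ≠ β) (e : Fin n → L × L) :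
    hammingNorm (quadraticCoordinates n hLF hβ e) = hammingNorm e :=
  hammingNorm_comp (fun _ => (Algebra.linearMap L F).coprod (LinearMap.toSpanSingleton L F β))
    (fun _ => injective_coprod_toSpanSingleton hβ) fun _ => map_zero _

/-- The code over pairs of scalars that corresponds to a code over a quadratic extension. -/
noncomputable def pairCode (hLF : Module.finrank L F = 2) (hβ : σ β ≠ β)
    (W : Submodule F (Fin n → F)) : Submodule L (Fin n → L × L) :=
  (W.restrictScalars L).comap (quadraticCoordinates n hLF hβ).toLinearMap

theorem mem_pairCode {hLF : Module.finrank L F = 2} {hβ : σ β ≠ β} {W : Submodule F (Fin n → F)}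
    {e : Fin n → L × L} : e ∈ pairCode hLF hβ W ↔ quadraticCoordinates n hLF hβ e ∈ W := Iff.rfl

theorem finrank_pairCode (hLF : Module.finrank L F = 2) (hβ : σ β ≠ β)
    (W : Submodule F (Fin n → F)) :
    Module.finrank L (pairCode hLF hβ W) = 2 * Module.finrank F W := by
  rw [pairCode, ← LinearEquiv.finrank_map_eq (quadraticCoordinates n hLF hβ),
    Submodule.map_comap_eq_of_surjective (LinearEquiv.surjective _), ← hLF,
    Module.finrank_mul_finrank L F W]
  rfl

theorem sub_mul_algebraMap_symplecticForm (hσ : Function.Involutive σ)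
    (hLF : Module.finrank L F = 2) (hβ : σ β ≠ β) (e f : Fin n → L × L) :
    (β - σ β) * algebraMap L F (symplecticForm L (Fin n) e f) =
      quadraticCoordinates n hLF hβ e ⬝ᵥ (σ ∘ quadraticCoordinates n hLF hβ f) -
        σ (quadraticCoordinates n hLF hβ e ⬝ᵥ (σ ∘ quadraticCoordinates n hLF hβ f)) := by
  rw [symplecticForm_apply, dotProduct, map_sum, map_sum, ← Finset.sum_sub_distrib, Finset.mul_sum]
  refine Finset.sum_congr rfl fun i _ => ?_
  simp only [Function.comp_apply, quadraticCoordinates_apply, map_add, map_mul, map_sub,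
    AlgHom.commutes, hσ β]
  ring

theorem orthogonal_pairCode (hσ : Function.Involutive σ) (hLF : Module.finrank L F = 2)
    (hβ : σ β ≠ β) (W : Submodule F (Fin n → F)) :
    (symplecticForm L (Fin n)).orthogonal (pairCode hLF hβ W) =
      pairCode hLF hβ (hermitianDual (σ : F →+* F) W) := by
  set T := quadraticCoordinates n hLF hβ with hT
  ext e
  have form_eq := sub_mul_algebraMap_symplecticForm hσ hLF hβ e
  rw [mem_pairCode, mem_hermitianDual, LinearMap.BilinForm.mem_orthogonal_iff]
  refine ⟨fun he w hw => ?_, fun he f hf => ?_⟩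
  · by_contra h0
    have fixed (μ : F) : σ (σ μ * (T e ⬝ᵥ (σ ∘ w))) = σ μ * (T e ⬝ᵥ (σ ∘ w)) := by
      have smul_mem : T (T.symm (μ • w)) ∈ W := by
        rw [LinearEquiv.apply_symm_apply]
        exact W.smul_mem μ hw
      have form_eq_zero := form_eq (T.symm (μ • w))
      have comp_smul : σ ∘ (μ • w) = σ μ • (σ ∘ w) := funext fun i => map_mul σ μ (w i)
      rw [symplecticForm_swap, he _ smul_mem, neg_zero, map_zero, mul_zero, ← hT,
        LinearEquiv.apply_symm_apply, comp_smul, dotProduct_smul, smul_eq_mul, eq_comm,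
        sub_eq_zero] at form_eq_zero
      exact form_eq_zero.symm
    have fixed_one : σ (T e ⬝ᵥ (σ ∘ w)) = T e ⬝ᵥ (σ ∘ w) := by simpa using fixed 1
    have fixed_β := fixed β
    rw [map_mul, fixed_one] at fixed_β
    exact hβ (σ.injective (mul_right_cancel₀ h0 fixed_β))
  · have dotProduct_eq_zero : T e ⬝ᵥ (σ ∘ T f) = 0 := he _ hf
    have form_eq_zero := form_eq f
    rw [← hT, dotProduct_eq_zero, map_zero, sub_zero, mul_eq_zero,
      or_iff_right (sub_ne_zero.2 hβ.symm), map_eq_zero] at form_eq_zero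
    change symplecticForm L (Fin n) f e = 0
    rw [symplecticForm_swap, form_eq_zero, neg_zero]

theorem exists_eaqecc_of_hermitianDual [Fintype L] [DecidableEq L] [DecidableEq F] {m k c d : ℕ}
    (h2 : (2 : L) ≠ 0) (hσ : Function.Involutive σ) (hLF : Module.finrank L F = 2)
    (hβ : σ β ≠ β) {W : Submodule F (Fin n → F)} (hW : Module.finrank F W = m)
    (hk : 2 * m + k = n + c)
    (hc : Module.finrank F (W ⊓ hermitianDual (σ : F →+* F) W : Submodule F _) + c = m)
    (hd : ∀ v ∈ hermitianDual (σ : F →+* F) W, v ≠ 0 → d ≤ hammingNorm v)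
    (hd' : ∃ v ∈ hermitianDual (σ : F →+* F) W, v ∉ W ∧ hammingNorm v = d) :
    ∃ Q : EAQECC L n k c, Q.HasMinDist d := by
  refine exists_eaqecc_hasMinDist h2 (pairCode hLF hβ W) ?_ ?_ ?_ ?_
  · rw [finrank_pairCode, hW, hk]
  · have pairCode_inf : pairCode hLF hβ W ⊓ pairCode hLF hβ (hermitianDual (σ : F →+* F) W) =
        pairCode hLF hβ (W ⊓ hermitianDual (σ : F →+* F) W) := rfl
    rw [orthogonal_pairCode hσ, pairCode_inf, finrank_pairCode, finrank_pairCode]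
    omega
  · intro e he he0
    rw [orthogonal_pairCode hσ] at he
    rw [← hammingNorm_quadraticCoordinates hLF hβ]
    exact hd _ he (by simpa using he0)
  · obtain ⟨v, hv, hvW, rfl⟩ := hd'
    rw [orthogonal_pairCode hσ]
    refine ⟨(quadraticCoordinates n hLF hβ).symm v, ?_, ?_, ?_⟩
    · rwa [mem_pairCode, LinearEquiv.apply_symm_apply]
    · rwa [mem_pairCode, LinearEquiv.apply_symm_apply]
    · rw [← hammingNorm_quadraticCoordinates hLF hβ, LinearEquiv.apply_symm_apply]

theorem exists_eaqecc_of_isParityCheck [Fintype L] [DecidableEq L] [DecidableEq F] {m k d : ℕ}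
    (h2 : (2 : F) ≠ 0) (hLF : Module.finrank L F = 2) {C : Submodule F (Fin n → F)}
    {H : Matrix (Fin m) (Fin n) F} (hH : IsParityCheck C H)
    (hk : 2 * m + k = n + (H * hermTranspose (Fintype.card L) H).rank)
    (hd : ∀ v ∈ C, v ≠ 0 → d ≤ hammingNorm v)
    (hd' : ∃ v ∈ C, hammingNorm v = d ∧ ∃ w ∈ C, ∑ i, w i * v i ^ Fintype.card L ≠ 0) :
    ∃ Q : EAQECC L n k (H * hermTranspose (Fintype.card L) H).rank, Q.HasMinDist d := by
  have : FiniteDimensional L F := Module.finite_of_finrank_pos (by omega)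
  have : Finite F := Module.finite_of_finite L
  let σ : F →ₐ[L] F := FiniteField.frobeniusAlgHom L F
  have orderOf_σ : orderOf σ = 2 := hLF ▸ FiniteField.orderOf_frobeniusAlgHom L F
  obtain ⟨sq_eq_one, ne_one⟩ := (orderOf_eq_prime_iff).1 orderOf_σ
  have hσ : Function.Involutive σ := fun x => congr($sq_eq_one x)
  obtain ⟨β, hβ⟩ : ∃ β, σ β ≠ β := by
    by_contra! h
    exact ne_one (AlgHom.ext h)
  have h2L : (2 : L) ≠ 0 := fun h => h2 (by rw [← map_ofNat (algebraMap L F) 2, h, map_zero])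
  let G := hermTranspose (Fintype.card L) H
  have G_injective : Function.Injective G.mulVecLin := hH.injective_mulVecLin_transpose_map σ
  have dual_eq : hermitianDual (σ : F →+* F) (LinearMap.range G.mulVecLin) = C :=
    (hermitianDual_range hσ H).trans hH.ker_mulVecLin
  refine exists_eaqecc_of_hermitianDual (W := LinearMap.range G.mulVecLin) h2L hσ hLF hβ
    (m := m) ?_ hk ?_ ?_ ?_
  · rw [LinearMap.finrank_range_of_inj G_injective, Module.finrank_fin_fun]
  · rw [dual_eq, ← hH.ker_mulVecLin, Matrix.rank, Matrix.mulVecLin_mul,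
      finrank_range_inf_ker_add_finrank_range_comp G_injective, Module.finrank_fin_fun]
  · rwa [dual_eq]
  · obtain ⟨v, hv, hwt, w, hw, hne⟩ := hd'
    rw [← dual_eq] at hv hw
    exact ⟨v, hv, fun hvW => hne (hw v hvW), hwt⟩

end HermitianConstruction

section Alphabet

variable {F : Type*} [Field F] [Fintype F] {q : ℕ}

theorem exists_field_fin_finrank_eq_two (hF : Fintype.card F = q ^ 2) :
    ∃ (_ : Field (Fin q)) (_ : Algebra (Fin q) F), Module.finrank (Fin q) F = 2 := by
  obtain ⟨p, _⟩ := CharP.exists F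
  obtain ⟨m, hp, hm⟩ := FiniteField.card F p
  have : Fact p.Prime := ⟨hp⟩
  obtain ⟨j, -, rfl⟩ := (Nat.dvd_prime_pow hp).1 (hm ▸ hF ▸ dvd_pow_self q two_ne_zero)
  have j_ne_zero : j ≠ 0 := fun h => (Fintype.one_lt_card (α := F)).ne' (by simp [hF, h])
  let _ : Algebra (ZMod p) F := ZMod.algebra F p
  have finrank_F : Module.finrank (ZMod p) F = j * 2 := by
    have card_eq := Module.card_eq_pow_finrank (K := ZMod p) (V := F)
    rw [hF, ZMod.card, ← pow_mul] at card_eq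
    exact (Nat.pow_right_injective hp.two_le card_eq).symm
  obtain ⟨φ⟩ : Nonempty (GaloisField p j →ₐ[ZMod p] F) :=
    FiniteField.nonempty_algHom_of_finrank_dvd <| by
      rw [GaloisField.finrank p j_ne_zero, finrank_F]
      exact dvd_mul_right j 2
  have := Fintype.ofFinite (GaloisField p j)
  let ε : Fin (p ^ j) ≃ GaloisField p j := Fintype.equivOfCardEq <| by
    rw [Fintype.card_fin, ← Nat.card_eq_fintype_card, GaloisField.card p j j_ne_zero]
  let _ : Field (Fin (p ^ j)) := ε.field
  let _ : Algebra (Fin (p ^ j)) F := ((φ : GaloisField p j →+* F).comp ε.ringEquiv).toAlgebra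
  have card_eq := Module.card_eq_pow_finrank (K := Fin (p ^ j)) (V := F)
  rw [hF, Fintype.card_fin] at card_eq
  exact ⟨‹_›, ‹_›, (Nat.pow_right_injective (Nat.one_lt_pow j_ne_zero hp.one_lt) card_eq).symm⟩

theorem exists_eaqecc_fin_of_isParityCheck [DecidableEq F] (hF : Fintype.card F = q ^ 2)
    (h2 : (2 : F) ≠ 0) {n m k d : ℕ} {C : Submodule F (Fin n → F)} {H : Matrix (Fin m) (Fin n) F}
    (hH : IsParityCheck C H) (hk : 2 * m + k = n + (H * hermTranspose q H).rank)
    (hd : ∀ v ∈ C, v ≠ 0 → d ≤ hammingNorm v)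
    (hd' : ∃ v ∈ C, hammingNorm v = d ∧ ∃ w ∈ C, ∑ i, w i * v i ^ q ≠ 0) :
    ∃ Q : EAQECC (Fin q) n k (H * hermTranspose q H).rank, Q.HasMinDist d := by
  obtain ⟨_, _, finrank_eq_two⟩ := exists_field_fin_finrank_eq_two hF
  have exists_eaqecc := exists_eaqecc_of_isParityCheck (L := Fin q) (k := k) (d := d) h2
    finrank_eq_two hH
  rw [Fintype.card_fin] at exists_eaqecc
  exact exists_eaqecc hk hd hd'

end Alphabet

/-! ### Defining sets -/

section Exponents

variable {q r n s : ℕ}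

/-- The exponent `s + r t` modulo `r n`, an element of the progression `exponentSet r n` when
`s ≡ 1` modulo `r`. -/
def exponent (r n s : ℕ) (t : ℤ) : ZMod (r * n) :=
  (s : ZMod (r * n)) + (r : ZMod (r * n)) * (t : ZMod (r * n))

theorem exponent_eq_exponent_iff (hr : r ≠ 0) {t t' : ℤ} :
    exponent r n s t = exponent r n s t' ↔ (n : ℤ) ∣ t - t' := by
  have cast_mul (a : ℤ) : (r : ZMod (r * n)) * (a : ZMod (r * n)) = ((r * a : ℤ) : ZMod (r * n)) :=
    by push_cast; rfl
  rw [exponent, exponent, add_right_inj, cast_mul, cast_mul, ← sub_eq_zero, ← Int.cast_sub,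
    ZMod.intCast_zmod_eq_zero_iff_dvd, ← mul_sub, Nat.cast_mul]
  exact mul_dvd_mul_iff_left (by exact_mod_cast hr)

theorem exponent_neg_natCast (j : ℕ) :
    exponent r n s (-j) = (s : ZMod (r * n)) - (r : ZMod (r * n)) * (j : ZMod (r * n)) := by
  rw [exponent, Int.cast_neg, Int.cast_natCast, mul_neg, sub_eq_add_neg]

theorem neg_mul_exponent (hs : n ∣ s) (t : ℤ) :
    -((q : ZMod ((q + 1) * n)) * exponent (q + 1) n s t) = exponent (q + 1) n s (-(q * t)) := by
  have succ_mul_eq_zero : ((q : ZMod ((q + 1) * n)) + 1) * s = 0 := by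
    exact_mod_cast (ZMod.natCast_eq_zero_iff _ _).2 (mul_dvd_mul_left (q + 1) hs)
  rw [exponent, exponent]
  push_cast
  linear_combination -succ_mul_eq_zero

theorem exponent_mul_sq (hn : n ∣ q ^ 2 + 1) (hs : n ∣ s) (t : ℤ) :
    exponent (q + 1) n s t * (q : ZMod ((q + 1) * n)) ^ 2 = exponent (q + 1) n s (-t) := by
  calc _ = -((q : ZMod ((q + 1) * n)) * -(q * exponent (q + 1) n s t)) := by ring
    _ = exponent (q + 1) n s (-(q * -(q * t))) := by rw [neg_mul_exponent hs, neg_mul_exponent hs]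
    _ = exponent (q + 1) n s (-t) := by
      rw [exponent_eq_exponent_iff q.succ_ne_zero]
      have : (n : ℤ) ∣ q ^ 2 + 1 := by exact_mod_cast hn
      rw [show -(q * -(q * t)) - -t = ((q : ℤ) ^ 2 + 1) * t by ring]
      exact this.mul_right t

theorem cyclotomicCoset_exponent (hn : n ∣ q ^ 2 + 1) (hs : n ∣ s) (t : ℤ) :
    cyclotomicCoset q ((q + 1) * n) (exponent (q + 1) n s t) =
      {exponent (q + 1) n s t, exponent (q + 1) n s (-t)} := by
  have mul_pow (j : ℕ) : exponent (q + 1) n s t * (q : ZMod ((q + 1) * n)) ^ (2 * j) =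
      exponent (q + 1) n s ((-1) ^ j * t) := by
    induction j with
    | zero => simp
    | succ j ih => rw [Nat.mul_succ, pow_add, ← mul_assoc, ih, exponent_mul_sq hn hs, pow_succ',
        mul_assoc, neg_one_mul]
  ext x
  constructor
  · rintro ⟨j, rfl⟩
    rw [mul_pow]
    rcases neg_one_pow_eq_or ℤ j with hj | hj <;> simp [hj]
  · rintro (rfl | rfl)
    · exact ⟨0, by simp⟩
    · exact ⟨1, by rw [mul_pow, pow_one, neg_one_mul]⟩

theorem iUnion_cyclotomicCoset (hn : n ∣ q ^ 2 + 1) (hs : n ∣ s) (T : ℕ) :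
    (⋃ j ∈ Set.Iic T, cyclotomicCoset q ((q + 1) * n)
      ((s : ZMod ((q + 1) * n)) - ((q + 1 : ℕ) : ZMod ((q + 1) * n)) * (j : ZMod ((q + 1) * n)))) =
    exponent (q + 1) n s '' {t | |t| ≤ T} := by
  ext x
  simp only [Set.mem_iUnion, Set.mem_Iic, exists_prop, ← exponent_neg_natCast,
    cyclotomicCoset_exponent hn hs, neg_neg, Set.mem_insert_iff, Set.mem_singleton_iff,
    Set.mem_image, Set.mem_ofPred_eq]
  constructor
  · rintro ⟨j, hj, rfl | rfl⟩
    · exact ⟨-j, by rw [abs_neg, Nat.abs_cast]; exact_mod_cast hj, rfl⟩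
    · exact ⟨j, by rw [Nat.abs_cast]; exact_mod_cast hj, rfl⟩
  · rintro ⟨t, ht, rfl⟩
    refine ⟨t.natAbs, by rw [abs_le] at ht; omega, ?_⟩
    rcases Int.natAbs_eq t with h | h
    · exact .inr (by rw [← h])
    · exact .inl (by rw [← h])

end Exponents

section Lattice

variable {a b : ℤ}

theorem abs_add_abs_le_one_of_lattice {x y : ℤ} (ha : 0 < a) (hb : 0 < b)
    (h₁ : |a * x + b * y| < a + b) (h₂ : |b * x - a * y| < a + b) : |x| + |y| ≤ 1 := by
  have sq_add_sq_lt : x ^ 2 + y ^ 2 < 4 := by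
    have norm_lt : (x ^ 2 + y ^ 2) * (a ^ 2 + b ^ 2) < 4 * (a ^ 2 + b ^ 2) := by
      nlinarith [sq_nonneg (a - b), sq_lt_sq' (abs_lt.1 h₁).1 (abs_lt.1 h₁).2,
        sq_lt_sq' (abs_lt.1 h₂).1 (abs_lt.1 h₂).2]
    exact lt_of_mul_lt_mul_right norm_lt (by positivity)
  have hx : |x| ≤ 1 := abs_le.2 ⟨by nlinarith [sq_nonneg y], by nlinarith [sq_nonneg y]⟩
  have hy : |y| ≤ 1 := abs_le.2 ⟨by nlinarith [sq_nonneg x], by nlinarith [sq_nonneg x]⟩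
  rw [abs_le] at hx hy
  obtain ⟨hx, hx'⟩ := hx
  obtain ⟨hy, hy'⟩ := hy
  rw [abs_lt] at h₁ h₂
  interval_cases x <;> interval_cases y <;> first | omega | decide

/-- The solutions `(t, t')` of `t + q t' ≡ 0` form the lattice spanned by `(a, b)` and `(b, -a)`. -/
theorem mem_of_dvd_add_mul {q n t t' : ℤ} (ha : 0 < a) (hb : 0 < b) (hn : n = a ^ 2 + b ^ 2)
    (hab : n ∣ b - q * a) (hba : n ∣ a + q * b) (ht : |t| < a + b) (ht' : |t'| < a + b)
    (h : n ∣ t + q * t') : t ∈ ({0, b, -b, a, -a} : Set ℤ) := by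
  obtain ⟨x, hx⟩ : n ∣ a * t + b * t' := by
    rw [show a * t + b * t' = a * (t + q * t') + (b - q * a) * t' by ring]
    exact dvd_add (h.mul_left a) (hab.mul_right t')
  obtain ⟨y, hy⟩ : n ∣ b * t - a * t' := by
    rw [show b * t - a * t' = b * (t + q * t') - (a + q * b) * t' by ring]
    exact dvd_sub (h.mul_left b) (hba.mul_right t')
  have n_ne_zero : n ≠ 0 := by rw [hn]; positivity
  have t_eq : t = a * x + b * y := mul_left_cancel₀ n_ne_zero (by
    linear_combination t * hn + a * hx + b * hy)
  have t'_eq : t' = b * x - a * y := mul_left_cancel₀ n_ne_zero (by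
    linear_combination t' * hn + b * hx - a * hy)
  have small := abs_add_abs_le_one_of_lattice ha hb (t_eq ▸ ht) (t'_eq ▸ ht')
  have x_bounds := abs_le.1 ((le_add_of_nonneg_right (abs_nonneg y)).trans small)
  have y_bounds := abs_le.1 ((le_add_of_nonneg_left (abs_nonneg x)).trans small)
  obtain ⟨hx, hx'⟩ := x_bounds
  obtain ⟨hy, hy'⟩ := y_bounds
  interval_cases x <;> interval_cases y <;> simp_all

end Lattice

section Intersection

variable {q n s : ℕ}

theorem inter_negMulSet_exponent {a b T : ℤ} (ha : 0 < a) (hb : 0 < b) (hn : n = a ^ 2 + b ^ 2)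
    (hab : (n : ℤ) ∣ b - q * a) (hba : (n : ℤ) ∣ a + q * b) (hs : n ∣ s) (haT : a ≤ T)
    (hbT : b ≤ T) (hT : T < a + b) :
    exponent (q + 1) n s '' {t | |t| ≤ T} ∩
        negMulSet q (exponent (q + 1) n s '' {t | |t| ≤ T}) =
      exponent (q + 1) n s '' {0, b, -b, a, -a} := by
  have neg_mul_eq_iff (t t' : ℤ) : -((q : ZMod ((q + 1) * n)) * exponent (q + 1) n s t') =
      exponent (q + 1) n s t ↔ (n : ℤ) ∣ t + q * t' := by
    rw [neg_mul_exponent hs, eq_comm, exponent_eq_exponent_iff q.succ_ne_zero, sub_neg_eq_add]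
  ext x
  constructor
  · rintro ⟨⟨t, ht, rfl⟩, ⟨_, ⟨t', ht', rfl⟩, h⟩⟩
    exact ⟨t, mem_of_dvd_add_mul ha hb hn hab hba (ht.trans_lt hT) (ht'.trans_lt hT)
      ((neg_mul_eq_iff t t').1 h), rfl⟩
  · rintro ⟨t, ht, rfl⟩
    have abs_le_T : |t| ≤ T := by
      rcases ht with rfl | rfl | rfl | rfl | rfl <;> rw [abs_le] <;> omega
    obtain ⟨t', ht', dvd⟩ : ∃ t', |t'| ≤ T ∧ (n : ℤ) ∣ t + q * t' := by
      rcases ht with rfl | rfl | rfl | rfl | rfl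
      · exact ⟨0, by rw [abs_zero]; omega, by simp⟩
      · exact ⟨-a, by rw [abs_le]; omega, by rwa [mul_neg, ← sub_eq_add_neg]⟩
      · exact ⟨a, by rw [abs_le]; omega, by rwa [← dvd_neg, neg_add, neg_neg, ← sub_eq_add_neg]⟩
      · exact ⟨b, by rw [abs_le]; omega, hba⟩
      · exact ⟨-b, by rw [abs_le]; omega, by rwa [mul_neg, ← neg_add, dvd_neg]⟩
    exact ⟨⟨t, abs_le_T, rfl⟩, _, ⟨t', ht', rfl⟩, (neg_mul_eq_iff t t').2 dvd⟩

theorem ncard_exponent_image {r : ℕ} {a b : ℤ} (ha : 0 < a) (hab : a < b) (hn : 2 * b < n)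
    (hr : r ≠ 0) : (exponent r n s '' {0, b, -b, a, -a}).ncard = 5 := by
  rw [Set.InjOn.ncard_image]
  · have coe_finset : ({0, b, -b, a, -a} : Set ℤ) = (({0, b, -b, a, -a} : Finset ℤ) : Set ℤ) := by
      simp
    rw [coe_finset, Set.ncard_coe_finset]
    repeat rw [Finset.card_insert_of_notMem
      (by simp only [Finset.mem_insert, Finset.mem_singleton, not_or]; omega)]
    rw [Finset.card_singleton]
  · intro t ht t' ht' h
    rw [exponent_eq_exponent_iff hr] at h
    have abs_sub_lt : |t - t'| < n := by
      simp only [Set.mem_insert_iff, Set.mem_singleton_iff] at ht ht'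
      rw [abs_lt]
      omega
    exact sub_eq_zero.1 (Int.eq_zero_of_abs_lt_dvd h abs_sub_lt)

theorem inter_negMulSet_eq_union_cyclotomicCoset {a b T : ℕ} (ha : 0 < a) (hab : a < b)
    (hn : n = a ^ 2 + b ^ 2) (hq : n ∣ q ^ 2 + 1) (hqa : (n : ℤ) ∣ b - q * a)
    (hqb : (n : ℤ) ∣ a + q * b) (hs : n ∣ s) (hbT : b ≤ T) (hT : T < a + b)
    {Z : Set (ZMod ((q + 1) * n))} (hZ : Z = exponent (q + 1) n s '' {t | |t| ≤ T}) :
    Z ∩ negMulSet q Z = cyclotomicCoset q ((q + 1) * n) s ∪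
        cyclotomicCoset q ((q + 1) * n) (s - ((q + 1 : ℕ) : ZMod ((q + 1) * n)) * b) ∪
        cyclotomicCoset q ((q + 1) * n) (s - ((q + 1 : ℕ) : ZMod ((q + 1) * n)) * a) ∧
      (Z ∩ negMulSet q Z).ncard = 5 := by
  have inter_eq := inter_negMulSet_exponent (T := T) (by exact_mod_cast ha)
    (by exact_mod_cast ha.trans hab) (by exact_mod_cast hn) hqa hqb hs (by omega) (by omega)
    (by exact_mod_cast hT)
  have exponent_zero : (s : ZMod ((q + 1) * n)) = exponent (q + 1) n s 0 := by simp [exponent]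
  refine ⟨?_, ?_⟩
  · rw [hZ, inter_eq, ← exponent_neg_natCast, ← exponent_neg_natCast, exponent_zero,
      cyclotomicCoset_exponent hq hs, cyclotomicCoset_exponent hq hs,
      cyclotomicCoset_exponent hq hs, neg_neg, neg_neg, neg_zero]
    simp only [Set.image_insert_eq, Set.image_singleton]
    ext x
    simp only [Set.mem_insert_iff, Set.mem_singleton_iff, Set.mem_union]
    tauto
  · rw [hZ, inter_eq]
    exact ncard_exponent_image (by exact_mod_cast ha) (by exact_mod_cast hab)
      (by rw [hn]; push_cast; nlinarith) q.succ_ne_zero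

end Intersection

section DefiningSet

open Polynomial

variable {F K : Type*} [Field F] [Field K] [Algebra F K] {n r : ℕ} {α : F} {δ : K}
  {C : Submodule F (Fin n → F)} {Z : Set (ZMod (r * n))}

theorem wordPoly_eq_ofFn [DecidableEq F] (c : Fin n → F) : wordPoly c = ofFn n c :=
  (ofFn_eq_sum_monomial c).symm

theorem aeval_wordPoly (c : Fin n → F) (x : K) :
    aeval x (wordPoly c) = ∑ l, algebraMap F K (c l) * x ^ (l : ℕ) := by
  simp only [wordPoly, map_sum, aeval_monomial]

theorem IsGeneratorPoly.finrank_add_natDegree [NeZero n] {g : F[X]} (hg : IsGeneratorPoly α C g) :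
    Module.finrank F C + g.natDegree = n := by
  classical
  let f : (Fin n → F) →ₗ[F] F[X] ⧸ Ideal.span {g} :=
    (Ideal.Quotient.mkₐ F (Ideal.span {g})).toLinearMap ∘ₗ ofFn n
  have ker_eq : LinearMap.ker f = C := by
    ext c
    rw [hg.2.2, wordPoly_eq_ofFn]
    exact Ideal.Quotient.eq_zero_iff_dvd _ _
  have natDegree_le : g.natDegree ≤ n :=
    natDegree_X_pow_sub_C (R := F) (n := n) (r := α) ▸
      natDegree_le_of_dvd hg.2.1 (X_pow_sub_C_ne_zero (NeZero.pos n) α)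
  have range_eq_top : LinearMap.range f = ⊤ := LinearMap.range_eq_top.2 fun y => by
    obtain ⟨p, rfl⟩ := Ideal.Quotient.mk_surjective y
    have natDegree_lt : (p %ₘ g).natDegree < n := by
      rcases eq_or_ne (p %ₘ g) 0 with h | h
      · rw [h, natDegree_zero]
        exact NeZero.pos n
      · exact (natDegree_lt_natDegree h (degree_modByMonic_lt p hg.1)).trans_le natDegree_le
    refine ⟨toFn n (p %ₘ g), ?_⟩
    change Ideal.Quotient.mk _ (ofFn n (toFn n (p %ₘ g))) = _
    rw [ofFn_comp_toFn_eq_id_of_natDegree_lt natDegree_lt, Ideal.Quotient.eq,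
      Ideal.mem_span_singleton, ← dvd_neg, neg_sub]
    exact ⟨p /ₘ g, by linear_combination -modByMonic_add_div p g⟩
  have rank_nullity := LinearMap.finrank_range_add_finrank_ker f
  rwa [ker_eq, range_eq_top, finrank_top, finrank_quotient_span_eq_natDegree,
    Module.finrank_fin_fun, add_comm] at rank_nullity

theorem injective_pow_val {N : ℕ} [NeZero N] (hδ : IsPrimitiveRoot δ N) :
    Function.Injective fun z : ZMod N => δ ^ z.val := fun z w h =>
  ZMod.val_injective N (hδ.pow_inj z.val_lt w.val_lt h)

theorem HasDefiningSet.subset_exponentSet (hZ : HasDefiningSet r α δ C Z) :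
    Z ⊆ exponentSet r n := by
  obtain ⟨g, -, rfl⟩ := hZ
  exact fun _ hz => hz.1

theorem HasDefiningSet.sum_eq_zero (hZ : HasDefiningSet r α δ C Z) {c : Fin n → F} (hc : c ∈ C)
    {z : ZMod (r * n)} (hz : z ∈ Z) :
    ∑ l, algebraMap F K (c l) * (δ ^ z.val) ^ (l : ℕ) = 0 := by
  obtain ⟨g, hg, rfl⟩ := hZ
  rw [← aeval_wordPoly]
  exact aeval_eq_zero_of_dvd_aeval_eq_zero ((hg.2.2 c).1 hc) hz.2

variable [NeZero r] [NeZero n]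

theorem image_pow_val_exponentSet (hδ : IsPrimitiveRoot δ (r * n)) :
    (fun z : ZMod (r * n) => δ ^ z.val) '' exponentSet r n = {x | x ^ n = δ ^ n} := by
  have δ_ne_zero : δ ≠ 0 := hδ.ne_zero (NeZero.ne _)
  have pow_val (j : ℕ) : δ ^ (1 + (r : ZMod (r * n)) * j).val = δ * (δ ^ r) ^ j := by
    rw [← pow_mul, ← pow_succ', add_comm, ← AddChar.zmodChar_apply hδ.pow_eq_one]
    exact_mod_cast AddChar.zmodChar_apply' hδ.pow_eq_one (r * j + 1)
  ext x
  constructor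
  · rintro ⟨_, ⟨j, -, rfl⟩, rfl⟩
    beta_reduce
    rw [Set.mem_ofPred_eq, pow_val, mul_pow, pow_right_comm, ← pow_mul δ, hδ.pow_eq_one,
      one_pow, mul_one]
  · intro hx
    have div_pow_eq_one : (x / δ) ^ n = 1 := by
      rw [div_pow, hx, div_self (pow_ne_zero n δ_ne_zero)]
    obtain ⟨j, hj, eq_div⟩ :=
      (hδ.pow (NeZero.pos (r * n)) rfl).eq_pow_of_pow_eq_one div_pow_eq_one
    exact ⟨_, ⟨j, hj, rfl⟩, by beta_reduce; rw [pow_val, eq_div, mul_div_cancel₀ x δ_ne_zero]⟩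

theorem IsGeneratorPoly.ncard_rootSet (hδ : IsPrimitiveRoot δ (r * n))
    (hδα : δ ^ n = algebraMap F K α) {g : F[X]} (hg : IsGeneratorPoly α C g) :
    (g.rootSet K).ncard = g.natDegree := by
  have primitiveRoot : IsPrimitiveRoot (δ ^ r) n := hδ.pow (NeZero.pos (r * n)) rfl
  have separable : g.Separable := by
    refine (separable_X_pow_sub_C α (fun h => ?_) (fun h => ?_)).of_dvd hg.2.1
    · exact primitiveRoot.neZero'.out (by rw [← map_natCast (algebraMap F K), h, map_zero])
    · exact pow_ne_zero n (hδ.ne_zero (NeZero.ne _)) (by rw [hδα, h, map_zero])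
  have splits : (g.map (algebraMap F K)).Splits := by
    refine (X_pow_sub_C_splits_of_isPrimitiveRoot primitiveRoot hδα).of_dvd
      (X_pow_sub_C_ne_zero (NeZero.pos n) _) ?_
    simpa only [Polynomial.map_sub, Polynomial.map_pow, map_X, map_C] using
      Polynomial.map_dvd (algebraMap F K) hg.2.1
  rw [← Nat.card_coe_set_eq, Nat.card_eq_fintype_card, card_rootSet_eq_natDegree separable splits]

theorem HasDefiningSet.finrank_add_ncard (hδ : IsPrimitiveRoot δ (r * n))
    (hδα : δ ^ n = algebraMap F K α) (hZ : HasDefiningSet r α δ C Z) :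
    Module.finrank F C + Z.ncard = n := by
  classical
  obtain ⟨g, hg, rfl⟩ := hZ
  have rootSet_eq : g.rootSet K = (fun z : ZMod (r * n) => δ ^ z.val) ''
      {z | z ∈ exponentSet r n ∧ aeval (δ ^ z.val) g = 0} := by
    ext x
    rw [mem_rootSet_of_ne hg.1.ne_zero]
    constructor
    · intro hx
      have pow_eq : x ^ n = δ ^ n := by
        have := aeval_eq_zero_of_dvd_aeval_eq_zero hg.2.1 hx
        rwa [map_sub, map_pow, aeval_X, aeval_C, sub_eq_zero, ← hδα] at this
      obtain ⟨z, hz, rfl⟩ := (image_pow_val_exponentSet hδ).ge pow_eq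
      exact ⟨z, ⟨hz, hx⟩, rfl⟩
    · rintro ⟨z, hz, rfl⟩
      exact hz.2
  rw [← Set.ncard_image_of_injective _ (injective_pow_val hδ), ← rootSet_eq,
    hg.ncard_rootSet hδ hδα, hg.finrank_add_natDegree]

end DefiningSet

/-! ### Codes with consecutive exponents -/

section MinimumDistance

variable {F K : Type*} [Field F] [Field K] [Algebra F K] {n m r s : ℕ} {α : F} {δ : K}
  {C : Submodule F (Fin n → F)} {Z : Set (ZMod (r * n))}

theorem lt_hammingNorm_of_sum_mul_pow_eq_zero {ι : Type*} [Fintype ι] [DecidableEq K] {y v : ι → K}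
    (hv : Function.Injective v) (h : ∀ i < m, ∑ l, y l * v l ^ i = 0) (hy : y ≠ 0) :
    m < hammingNorm y := by
  by_contra! hm
  let e : {l // y l ≠ 0} ≃ Fin (hammingNorm y) :=
    Fintype.equivFinOfCardEq (Fintype.card_subtype fun l => y l ≠ 0)
  have restrict_eq_zero : (fun i => y (e.symm i)) = 0 := by
    refine Matrix.eq_zero_of_forall_pow_sum_mul_pow_eq_zero (f := fun i => v (e.symm i))
      (hv.comp (Subtype.val_injective.comp e.symm.injective)) fun i => ?_
    rw [e.symm.sum_comp fun l => y l * v l ^ (i : ℕ),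
      ← Finset.sum_subtype (Finset.univ.filter (y · ≠ 0)) (fun l => Finset.mem_filter_univ l)
        fun l => y l * v l ^ (i : ℕ)]
    exact (Finset.sum_filter_of_ne fun l _ => left_ne_zero_of_mul).trans (h i (i.2.trans_le hm))
  refine hy (funext fun l => ?_)
  by_contra hl
  have := congrFun restrict_eq_zero (e ⟨l, hl⟩)
  rw [e.symm_apply_apply] at this
  exact hl this

theorem pow_val_exponent_add [NeZero r] [NeZero n] (hδ : IsPrimitiveRoot δ (r * n)) (t : ℤ)
    (i : ℕ) : δ ^ (exponent r n s (t + i)).val = δ ^ (exponent r n s t).val * (δ ^ r) ^ i := by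
  have exponent_add : exponent r n s (t + i) = exponent r n s t + (r * i : ℕ) := by
    rw [exponent, exponent]
    push_cast
    ring
  rw [← pow_mul, ← AddChar.zmodChar_apply hδ.pow_eq_one, ← AddChar.zmodChar_apply hδ.pow_eq_one,
    exponent_add, AddChar.map_add_eq_mul, AddChar.zmodChar_apply']

theorem HasDefiningSet.lt_hammingNorm [DecidableEq F] [NeZero r] [NeZero n]
    (hδ : IsPrimitiveRoot δ (r * n)) (hZ : HasDefiningSet r α δ C Z) {t : ℤ}
    (hm : exponent r n s '' Set.Ico t (t + m) ⊆ Z) {c : Fin n → F} (hc : c ∈ C) (hc0 : c ≠ 0) :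
    m < hammingNorm c := by
  classical
  let x := δ ^ (exponent r n s t).val
  let y : Fin n → K := fun l => algebraMap F K (c l) * x ^ (l : ℕ)
  have x_ne_zero : x ≠ 0 := pow_ne_zero _ (hδ.ne_zero (NeZero.ne _))
  have y_eq_zero_iff (l : Fin n) : y l = 0 ↔ c l = 0 := by
    simp only [y, mul_eq_zero, map_eq_zero, pow_ne_zero _ x_ne_zero, or_false]
  have hammingNorm_y : hammingNorm y = hammingNorm c := by
    simp only [hammingNorm, ne_eq, y_eq_zero_iff]
  rw [← hammingNorm_y]
  refine lt_hammingNorm_of_sum_mul_pow_eq_zero (v := fun l : Fin n => (δ ^ r) ^ (l : ℕ))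
    (fun l l' h => Fin.ext ((hδ.pow (NeZero.pos (r * n)) rfl).pow_inj l.2 l'.2 h))
    (fun i hi => ?_) (fun h => hc0 (funext fun l => (y_eq_zero_iff l).1 (congrFun h l)))
  rw [← hZ.sum_eq_zero hc (hm ⟨t + i, ⟨by omega, by omega⟩, rfl⟩)]
  refine Finset.sum_congr rfl fun l _ => ?_
  rw [pow_val_exponent_add hδ, mul_pow, pow_right_comm, mul_assoc]

theorem ncard_exponent_image_Ico (hr : r ≠ 0) (t : ℤ) (hm : m ≤ n) :
    (exponent r n s '' Set.Ico t (t + m)).ncard = m := by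
  rw [Set.InjOn.ncard_image fun a ha b hb h => ?_, Set.ncard_eq_toFinset_card', Set.toFinset_Ico,
    Int.card_Ico, add_sub_cancel_left, Int.toNat_natCast]
  rw [Set.mem_Ico] at ha hb
  exact sub_eq_zero.1 (Int.eq_zero_of_abs_lt_dvd ((exponent_eq_exponent_iff hr).1 h)
    (by rw [abs_lt]; omega))

end MinimumDistance

section MDS

variable {F : Type*} [Field F] {n m q : ℕ} {C : Submodule F (Fin n → F)}

theorem exists_mem_ne_zero_of_lt_finrank_add_card {S : Finset (Fin n)}
    (hS : n < Module.finrank F C + S.card) : ∃ c ∈ C, c ≠ 0 ∧ ∀ i ∉ S, c i = 0 := by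
  by_contra! h
  have disjoint : Disjoint C (Pi.spanSubset F (S : Set (Fin n))) :=
    Submodule.disjoint_def.2 fun c hc hcS => by
      by_contra hc0
      obtain ⟨i, hi, hci⟩ := h c hc hc0
      exact hci (Pi.mem_spanSubset_iff.1 hcS i hi)
  have := Submodule.finrank_add_finrank_le_of_disjoint disjoint
  rw [Pi.dim_spanSubset, Set.ncard_coe_finset, Module.finrank_fin_fun] at this
  omega

variable [DecidableEq F]

theorem exists_mem_ne_zero_iff_mem (hdim : Module.finrank F C + m = n)
    (hwt : ∀ c ∈ C, c ≠ 0 → m < hammingNorm c) {S : Finset (Fin n)} (hS : S.card = m + 1) :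
    ∃ c ∈ C, hammingNorm c = m + 1 ∧ ∀ i, c i ≠ 0 ↔ i ∈ S := by
  obtain ⟨c, hc, hc0, hcS⟩ := exists_mem_ne_zero_of_lt_finrank_add_card (C := C) (S := S) (by omega)
  have support_subset : Finset.univ.filter (c · ≠ 0) ⊆ S := fun i hi => by
    by_contra hiS
    exact (Finset.mem_filter.1 hi).2 (hcS i hiS)
  have support_eq := Finset.eq_of_subset_of_card_le support_subset (hS ▸ hwt c hc hc0)
  exact ⟨c, hc, hS ▸ congrArg Finset.card support_eq,
    fun i => by rw [← support_eq, Finset.mem_filter_univ]⟩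

theorem isMinWeight_of_forall_lt_hammingNorm (hdim : Module.finrank F C + m = n)
    (hwt : ∀ c ∈ C, c ≠ 0 → m < hammingNorm c) (hmn : m < n) : IsMinWeight C (m + 1) := by
  obtain ⟨c, hc, hcm, -⟩ := exists_mem_ne_zero_iff_mem hdim hwt (Fin.card_Iic ⟨m, hmn⟩)
  have c_ne_zero : c ≠ 0 := hammingNorm_ne_zero_iff.1 (by omega)
  refine ⟨⟨c, hc, c_ne_zero, hcm⟩, ?_⟩
  rintro _ ⟨c', hc', hc0', rfl⟩
  exact hwt c' hc' hc0'

theorem exists_hammingNorm_eq_and_sum_ne_zero (hdim : Module.finrank F C + m = n)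
    (hwt : ∀ c ∈ C, c ≠ 0 → m < hammingNorm c) (hmn : 2 * m < n) (hq : q ≠ 0) :
    ∃ c ∈ C, hammingNorm c = m + 1 ∧ ∃ c' ∈ C, ∑ i, c' i * c i ^ q ≠ 0 := by
  obtain ⟨a, ha⟩ : ∃ a : Fin n, (a : ℕ) = m := ⟨⟨m, by omega⟩, rfl⟩
  obtain ⟨b, hb⟩ : ∃ b : Fin n, (b : ℕ) = 2 * m := ⟨⟨2 * m, hmn⟩, rfl⟩
  obtain ⟨c, hc, hcm, hcS⟩ := exists_mem_ne_zero_iff_mem hdim hwt (S := Finset.Iic a)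
    (by rw [Fin.card_Iic, ha])
  obtain ⟨c', hc', -, hcS'⟩ := exists_mem_ne_zero_iff_mem hdim hwt (S := Finset.Icc a b)
    (by rw [Fin.card_Icc]; omega)
  refine ⟨c, hc, hcm, c', hc', ?_⟩
  -- The supports of `c` and `c'` meet in the single position `a`.
  rw [Finset.sum_eq_single a (fun i _ hia => ?_) (by simp)]
  · exact mul_ne_zero ((hcS' a).2 (Finset.mem_Icc.2 ⟨le_rfl, by rw [Fin.le_def]; omega⟩))
      (pow_ne_zero q ((hcS a).2 (Finset.mem_Iic.2 le_rfl)))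
  · by_contra h
    have le_a := Finset.mem_Iic.1 ((hcS i).1 (ne_zero_pow hq (right_ne_zero_of_mul h)))
    have a_le := (Finset.mem_Icc.1 ((hcS' i).1 (left_ne_zero_of_mul h))).1
    exact hia (le_antisymm le_a a_le)

end MDS

section Rank

theorem rank_map_ringHom {F K ι : Type*} [Field F] [Field K] [Fintype ι] (f : F →+* K)
    (M : Matrix ι ι F) : (M.map f).rank = M.rank := by
  classical
  obtain ⟨L, L', D, rfl⟩ := Matrix.Pivot.exists_list_transvec_mul_diagonal_mul_list_transvec M
  have isUnit_det (L : List (Matrix.TransvectionStruct ι F)) :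
      IsUnit (L.map Matrix.TransvectionStruct.toMatrix).prod.det := by
    rw [Matrix.TransvectionStruct.det_toMatrix_prod]
    exact isUnit_one
  have isUnit_det_map (L : List (Matrix.TransvectionStruct ι F)) :
      IsUnit ((L.map Matrix.TransvectionStruct.toMatrix).prod.map f).det := by
    rw [← f.mapMatrix_apply, ← f.map_det]
    exact (isUnit_det L).map f
  rw [Matrix.map_mul, Matrix.map_mul, Matrix.diagonal_map (map_zero f),
    Matrix.rank_mul_eq_left_of_isUnit_det _ _ (isUnit_det_map L'),
    Matrix.rank_mul_eq_right_of_isUnit_det _ _ (isUnit_det_map L),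
    Matrix.rank_mul_eq_left_of_isUnit_det _ _ (isUnit_det L'),
    Matrix.rank_mul_eq_right_of_isUnit_det _ _ (isUnit_det L), Matrix.rank_diagonal,
    Matrix.rank_diagonal]
  simp only [ne_eq, map_eq_zero]

theorem rank_eq_ncard_range_inter_range {K ι κ X : Type*} [Field K] [Finite ι] [Fintype κ]
    [DecidableEq X] {g : ι → X} {f : κ → X} (hg : Function.Injective g) {a : K} (ha : a ≠ 0)
    {M : Matrix ι κ K} (hM : ∀ i j, M i j = if g i = f j then a else 0) :
    M.rank = (Set.range g ∩ Set.range f).ncard := by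
  classical
  have span_cols : Submodule.span K (Set.range M.col) = Pi.spanSubset K (g ⁻¹' Set.range f) := by
    apply le_antisymm <;> refine Submodule.span_le.2 ?_
    · rintro _ ⟨j, rfl⟩
      exact Pi.mem_spanSubset_iff.2 fun i hi =>
        (hM i j).trans (if_neg fun h => hi ⟨j, h.symm⟩)
    · rintro _ ⟨i, ⟨j, hj⟩, rfl⟩
      have eq_smul : Pi.basisFun K ι i = a⁻¹ • M.col j := by
        ext i'
        simp only [Pi.basisFun_apply, Pi.single_apply, Pi.smul_apply, Matrix.col_apply, hM, hj,
          hg.eq_iff]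
        rw [smul_ite, smul_eq_mul, inv_mul_cancel₀ ha, smul_zero]
      rw [eq_smul]
      exact Submodule.smul_mem _ _ (Submodule.subset_span ⟨j, rfl⟩)
  rw [Matrix.rank_eq_finrank_span_cols, span_cols, Pi.dim_spanSubset,
    ← Set.ncard_image_of_injective _ hg, Set.image_preimage_eq_range_inter]

variable {F K : Type*} [Field F] [Field K] [Algebra F K] {n m q : ℕ} {α : F} {δ : K}
  {C : Submodule F (Fin n → F)} {H : Matrix (Fin m) (Fin n) F}

theorem IsParityCheck.exists_isUnit_mul_map_eq (hH : IsParityCheck C H)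
    {W : Matrix (Fin m) (Fin n) K} (hW : Function.Injective W.vecMul)
    (hWC : ∀ c ∈ C, W *ᵥ (algebraMap F K ∘ c) = 0) :
    ∃ P : Matrix (Fin m) (Fin m) K, IsUnit P ∧ W = P * H.map (algebraMap F K) := by
  obtain ⟨R, hR⟩ := hH.exists_mul_eq_one
  have mem_code (j : Fin n) : (1 - R * H).col j ∈ C := by
    have mul_eq_zero : H * (1 - R * H) = 0 := by
      rw [Matrix.mul_sub, Matrix.mul_one, ← Matrix.mul_assoc, hR, Matrix.one_mul, sub_self]
    exact (hH.2 _).2 (funext fun i => congrFun (congrFun mul_eq_zero i) j)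
  have W_mul_eq_zero : W * (1 - R * H).map (algebraMap F K) = 0 := by
    ext i j
    exact congrFun (hWC _ (mem_code j)) i
  have W_eq : W = W * R.map (algebraMap F K) * H.map (algebraMap F K) := by
    rwa [Matrix.map_sub _ (map_sub _), Matrix.map_one _ (map_zero _) (map_one _), Matrix.mul_sub,
      Matrix.mul_one, sub_eq_zero, Matrix.map_mul, ← Matrix.mul_assoc] at W_mul_eq_zero
  refine ⟨_, Matrix.vecMul_injective_iff_isUnit.1 fun y y' hy => hW ?_, W_eq⟩
  change y ᵥ* W = y' ᵥ* W
  rw [W_eq, ← Matrix.vecMul_vecMul, ← Matrix.vecMul_vecMul y']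
  exact congrArg (· ᵥ* _) hy

theorem IsParityCheck.rank_mul_hermTranspose (hH : IsParityCheck C H) {φ : K →+* K}
    (hφ : ∀ x, φ x = x ^ q) {W : Matrix (Fin m) (Fin n) K} (hW : Function.Injective W.vecMul)
    (hWC : ∀ c ∈ C, W *ᵥ (algebraMap F K ∘ c) = 0) :
    (H * hermTranspose q H).rank = (W * (W.map φ)ᵀ).rank := by
  obtain ⟨P, hP, rfl⟩ := hH.exists_isUnit_mul_map_eq hW hWC
  have map_hermTranspose : (hermTranspose q H).map (algebraMap F K) =
      ((H.map (algebraMap F K)).map φ)ᵀ := by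
    ext i j
    simp only [hermTranspose, Matrix.map_apply, Matrix.transpose_apply, map_pow, hφ]
  have mul_eq : P * H.map (algebraMap F K) * ((P * H.map (algebraMap F K)).map φ)ᵀ =
      P * (H * hermTranspose q H).map (algebraMap F K) * (P.map φ)ᵀ := by
    rw [Matrix.map_mul, Matrix.map_mul, Matrix.transpose_mul, map_hermTranspose]
    simp only [Matrix.mul_assoc]
  have isUnit_det_transpose : IsUnit (P.map φ)ᵀ.det := by
    rw [Matrix.det_transpose]
    exact (Matrix.isUnit_iff_isUnit_det _).1 (hP.map φ.mapMatrix)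
  rw [mul_eq, Matrix.rank_mul_eq_left_of_isUnit_det _ _ isUnit_det_transpose,
    Matrix.rank_mul_eq_right_of_isUnit_det _ _ ((Matrix.isUnit_iff_isUnit_det _).1 hP),
    rank_map_ringHom]

theorem exists_ringHom_forall_eq_pow [Fintype F] (hF : Fintype.card F = q ^ 2) :
    ∃ φ : K →+* K, ∀ x, φ x = x ^ q := by
  obtain ⟨p, _⟩ := CharP.exists F
  obtain ⟨e, hp, he⟩ := FiniteField.card F p
  obtain ⟨j, -, rfl⟩ := (Nat.dvd_prime_pow hp).1 (he ▸ hF ▸ dvd_pow_self q two_ne_zero)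
  have : Fact p.Prime := ⟨hp⟩
  have : CharP K p := charP_of_injective_algebraMap (algebraMap F K).injective p
  exact ⟨iterateFrobenius K p j, iterateFrobenius_def p j⟩

variable [NeZero n]

theorem sum_pow_mul_pow_pow_eq_ite (hδ : IsPrimitiveRoot δ ((q + 1) * n))
    {z w : ZMod ((q + 1) * n)} (hz : z ∈ exponentSet (q + 1) n) (hw : w ∈ exponentSet (q + 1) n) :
    ∑ l : Fin n, (δ ^ z.val) ^ (l : ℕ) * ((δ ^ w.val) ^ (l : ℕ)) ^ q =
      if z = -(q * w) then (n : K) else 0 := by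
  let ξ := δ ^ z.val * (δ ^ w.val) ^ q
  have sum_eq : ∑ l : Fin n, (δ ^ z.val) ^ (l : ℕ) * ((δ ^ w.val) ^ (l : ℕ)) ^ q =
      ∑ l ∈ Finset.range n, ξ ^ l := by
    rw [← Fin.sum_univ_eq_sum_range fun l => ξ ^ l]
    exact Finset.sum_congr rfl fun l _ => by
      rw [mul_pow, pow_right_comm (δ ^ w.val)]
  have pow_n_eq_one : ξ ^ n = 1 := by
    have hzn : (δ ^ z.val) ^ n = δ ^ n := (image_pow_val_exponentSet hδ).le ⟨z, hz, rfl⟩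
    have hwn : (δ ^ w.val) ^ n = δ ^ n := (image_pow_val_exponentSet hδ).le ⟨w, hw, rfl⟩
    rw [mul_pow, pow_right_comm (δ ^ w.val), hzn, hwn, ← pow_succ', ← pow_mul,
      mul_comm, hδ.pow_eq_one]
  have eq_one_iff : ξ = 1 ↔ z = -(q * w) := by
    rw [eq_neg_iff_add_eq_zero, ← (injective_pow_val hδ).eq_iff, ZMod.val_zero, pow_zero,
      ← AddChar.zmodChar_apply hδ.pow_eq_one, AddChar.map_add_eq_mul, ← nsmul_eq_mul,
      AddChar.map_nsmul_eq_pow, AddChar.zmodChar_apply, AddChar.zmodChar_apply]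
  rw [sum_eq]
  split_ifs with h
  · rw [eq_one_iff.2 h]
    simp only [one_pow, Finset.sum_const, Finset.card_range, nsmul_one]
  · have geom := geom_sum_mul ξ n
    rw [pow_n_eq_one, sub_self, mul_eq_zero] at geom
    exact geom.resolve_right (sub_ne_zero.2 (mt eq_one_iff.1 h))

theorem HasDefiningSet.rank_mul_hermTranspose [Fintype F] (hF : Fintype.card F = q ^ 2)
    (hδ : IsPrimitiveRoot δ ((q + 1) * n)) (hδα : δ ^ n = algebraMap F K α)
    {Z : Set (ZMod ((q + 1) * n))} (hZ : HasDefiningSet (q + 1) α δ C Z)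
    (hH : IsParityCheck C H) :
    (H * hermTranspose q H).rank = (Z ∩ negMulSet q Z).ncard := by
  classical
  have hZm : Nat.card Z = m := by
    have := hZ.finrank_add_ncard hδ hδα
    have := hH.1
    rw [Nat.card_coe_set_eq]
    omega
  have hmn : m ≤ n := hH.1.le.trans' le_add_self
  let e := (Finite.equivFinOfCardEq hZm).symm
  let W : Matrix (Fin m) (Fin n) K := .of fun i l => (δ ^ (e i : ZMod ((q + 1) * n)).val) ^ (l : ℕ)
  obtain ⟨φ, hφ⟩ := exists_ringHom_forall_eq_pow (K := K) hF
  have n_ne_zero : (n : K) ≠ 0 := (hδ.pow (NeZero.pos ((q + 1) * n)) rfl).neZero'.out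
  have val_injective : Function.Injective fun i => (e i : ZMod ((q + 1) * n)) :=
    Subtype.val_injective.comp e.injective
  have W_injective : Function.Injective W.vecMul :=
    (injective_iff_map_eq_zero W.vecMulLinear).2 fun y hy => by
      by_contra hy0
      have := lt_hammingNorm_of_sum_mul_pow_eq_zero (m := n)
        ((injective_pow_val hδ).comp val_injective) (fun l hl => congrFun hy ⟨l, hl⟩) hy0
      have := hammingNorm_le_card_fintype (x := y)
      rw [Fintype.card_fin] at this
      omega
  have W_mulVec (c) (hc : c ∈ C) : W *ᵥ (algebraMap F K ∘ c) = 0 := funext fun i =>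
    (Finset.sum_congr rfl fun l _ => mul_comm _ _).trans (hZ.sum_eq_zero hc (e i).2)
  have entry (i j) : (W * (W.map φ)ᵀ) i j =
      if (e i : ZMod ((q + 1) * n)) = -(q * (e j : ZMod ((q + 1) * n))) then (n : K) else 0 := by
    simp only [← sum_pow_mul_pow_pow_eq_ite hδ (hZ.subset_exponentSet (e i).2)
      (hZ.subset_exponentSet (e j).2), Matrix.mul_apply, W, Matrix.of_apply,
      Matrix.transpose_apply, Matrix.map_apply, hφ]
  have range_eq : Set.range (fun i => (e i : ZMod ((q + 1) * n))) = Z :=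
    (e.surjective.range_comp _).trans Subtype.range_coe
  have range_neg : Set.range (fun j => -(q * (e j : ZMod ((q + 1) * n)))) = negMulSet q Z :=
    (Set.range_comp (fun z : ZMod ((q + 1) * n) => -(q * z)) _).trans (congrArg _ range_eq)
  rw [hH.rank_mul_hermTranspose hφ W_injective W_mulVec,
    rank_eq_ncard_range_inter_range val_injective n_ne_zero entry, range_neg, range_eq]

end Rank

section ConsecutiveRoots

theorem setOf_abs_le_eq_Ico (T : ℕ) :
    {t : ℤ | |t| ≤ T} = Set.Ico (-(T : ℤ)) (-T + (2 * T + 1 : ℕ)) := by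
  ext t
  rw [Set.mem_ofPred_eq, abs_le, Set.mem_Ico]
  omega

theorem two_ne_zero_of_odd_card {F : Type*} [Field F] [Fintype F] (hF : Odd (Fintype.card F)) :
    (2 : F) ≠ 0 :=
  Ring.two_ne_zero fun h =>
    Nat.not_even_iff_odd.2 hF (Nat.even_iff.2 (FiniteField.even_card_of_char_two h))

variable {F K : Type*} [Field F] [Field K] [Algebra F K] {n m q r s : ℕ} [NeZero n] {t : ℤ} {α : F}
  {δ : K} {C : Submodule F (Fin n → F)}

theorem HasDefiningSet.finrank_add_eq_of_eq_image_Ico [NeZero r] {Z : Set (ZMod (r * n))}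
    (hδ : IsPrimitiveRoot δ (r * n)) (hδα : δ ^ n = algebraMap F K α)
    (hCZ : HasDefiningSet r α δ C Z) (hZ : Z = exponent r n s '' Set.Ico t (t + m)) (hmn : m ≤ n) :
    Module.finrank F C + m = n := by
  rw [← ncard_exponent_image_Ico (s := s) (NeZero.ne r) t hmn, ← hZ]
  exact hCZ.finrank_add_ncard hδ hδα

theorem HasDefiningSet.isMinWeight_of_eq_image_Ico [DecidableEq F] [NeZero r]
    {Z : Set (ZMod (r * n))} (hδ : IsPrimitiveRoot δ (r * n)) (hδα : δ ^ n = algebraMap F K α)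
    (hCZ : HasDefiningSet r α δ C Z) (hZ : Z = exponent r n s '' Set.Ico t (t + m)) (hmn : m < n) :
    IsMinWeight C (m + 1) :=
  isMinWeight_of_forall_lt_hammingNorm (hCZ.finrank_add_eq_of_eq_image_Ico hδ hδα hZ hmn.le)
    (fun _ => hCZ.lt_hammingNorm hδ hZ.ge) hmn

theorem HasDefiningSet.existsEAQMDS_of_eq_image_Ico [Fintype F] {Z : Set (ZMod ((q + 1) * n))}
    (hF : Fintype.card F = q ^ 2) (hq : Odd q) (hδ : IsPrimitiveRoot δ ((q + 1) * n))
    (hδα : δ ^ n = algebraMap F K α) (hCZ : HasDefiningSet (q + 1) α δ C Z)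
    (hZ : Z = exponent (q + 1) n s '' Set.Ico t (t + m)) (hmn : 2 * m < n) {k c : ℕ}
    (hc : (Z ∩ negMulSet q Z).ncard = c) (hk : 2 * m + k = n + c) :
    ExistsEAQMDS q n k (m + 1) c := by
  classical
  have weight_gt (v) : v ∈ C → v ≠ 0 → m < hammingNorm v := hCZ.lt_hammingNorm hδ hZ.ge
  have dim : Module.finrank F C + m = n :=
    hCZ.finrank_add_eq_of_eq_image_Ico hδ hδα hZ (by omega)
  obtain ⟨H, hH⟩ := exists_isParityCheck dim
  have rank_eq : (H * hermTranspose q H).rank = c :=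
    (hCZ.rank_mul_hermTranspose hF hδ hδα hH).trans hc
  have exists_eaqecc := exists_eaqecc_fin_of_isParityCheck (k := k) hF
    (two_ne_zero_of_odd_card (hF ▸ hq.pow)) hH (rank_eq ▸ hk) weight_gt
    (exists_hammingNorm_eq_and_sum_ne_zero dim weight_gt hmn hq.pos.ne')
  rw [rank_eq] at exists_eaqecc
  have two_mul_lt : (2 * m : ℚ) < n := by exact_mod_cast hmn
  have singleton_eq : (2 * m + k : ℚ) = n + c := by exact_mod_cast hk
  refine ⟨exists_eaqecc, ?_, ?_⟩ <;> push_cast <;> linarith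

end ConsecutiveRoots

theorem mainTheorem1
    (q n r s lam : ℕ) (hq : IsPrimePow q) (hq7 : q % 10 = 7) (hq_gt : 7 < q)
    (hn : 10 * n = q ^ 2 + 1) (hr : r = q + 1) (hs : 2 * s = q ^ 2 + 1)
    (hlam : 1 ≤ lam) (hlam' : (lam : ℚ) ≤ ((q : ℚ) + 3) / 10)
    {F K : Type*} [Field F] [Fintype F] [DecidableEq F] (hF : Fintype.card F = q ^ 2)
    [Field K] [Algebra F K]
    (α : F) (hα : IsPrimitiveRoot α r)
    (δ : K) (hδ : IsPrimitiveRoot δ (r * n)) (hδα : δ ^ n = algebraMap F K α)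
    (Z : Set (ZMod (r * n)))
    (hZ : Z = ⋃ j ∈ Set.Iic (3 * (q - 7) / 10 + 1 + lam),
      cyclotomicCoset q (r * n) ((s : ZMod (r * n)) - (r : ZMod (r * n)) * (j : ZMod (r * n))))
    (C : Submodule F (Fin n → F)) (hC : IsConstacyclic α C) (hCZ : HasDefiningSet r α δ C Z) :
    -- the intersection of `Z` and `-q Z` consists of exactly three cosets with five elements
    (Z ∩ negMulSet q Z =
        cyclotomicCoset q (r * n) (s : ZMod (r * n)) ∪
        cyclotomicCoset q (r * n)
          ((s : ZMod (r * n)) - (r : ZMod (r * n)) * (((3 * q - 1) / 10 : ℕ) : ZMod (r * n))) ∪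
        cyclotomicCoset q (r * n)
          ((s : ZMod (r * n)) - (r : ZMod (r * n)) * (((q + 3) / 10 : ℕ) : ZMod (r * n))) ∧
      (Z ∩ negMulSet q Z).ncard = 5) ∧
    ∃ k d : ℕ,
      (k : ℚ) = (n : ℚ) - 6 / 5 * ((q : ℚ) - 7) - 4 * lam - 1 ∧
      (d : ℚ) = 3 / 5 * ((q : ℚ) - 7) + 2 * lam + 4 ∧
      -- `C` has dimension `n - d + 1`, minimum distance `d`, and requires `5` entangled pairs
      Module.finrank F C + d = n + 1 ∧
      IsMinWeight C d ∧
      (∀ (m : ℕ) (H : Matrix (Fin m) (Fin n) F), IsParityCheck C H →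
        (H * hermTranspose q H).rank = 5) ∧
      -- existence of the entanglement-assisted quantum MDS code
      ExistsEAQMDS q n k d 5 := by
  subst hr
  obtain ⟨u, rfl⟩ : ∃ u, q = 10 * u + 7 := ⟨q / 10, by omega⟩
  have lam_le : lam ≤ u + 1 := by
    push_cast at hlam'
    exact_mod_cast show (lam : ℚ) ≤ u + 1 by linarith
  have n_eq : n = (u + 1) ^ 2 + (3 * u + 2) ^ 2 := by linarith
  have s_eq : s = n * 5 := by omega
  have lt_n : 2 * (2 * (3 * u + 1 + lam) + 1) < n := by
    nlinarith [show 1 ≤ u by omega]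
  have : NeZero n := ⟨by omega⟩
  rw [show (3 * (10 * u + 7) - 1) / 10 = 3 * u + 2 by omega,
    show (10 * u + 7 + 3) / 10 = u + 1 by omega]
  rw [show 3 * (10 * u + 7 - 7) / 10 + 1 + lam = 3 * u + 1 + lam by omega,
    iUnion_cyclotomicCoset ⟨10, by omega⟩ ⟨5, s_eq⟩] at hZ
  have inter := inter_negMulSet_eq_union_cyclotomicCoset u.succ_pos (by omega) n_eq
    ⟨10, by omega⟩ ⟨-1, by push_cast [n_eq]; ring⟩ ⟨3, by push_cast [n_eq]; ring⟩ ⟨5, s_eq⟩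
    (by omega) (by omega) hZ
  rw [setOf_abs_le_eq_Ico] at hZ
  have dim := hCZ.finrank_add_eq_of_eq_image_Ico hδ hδα hZ (by omega)
  obtain ⟨k, hk⟩ : ∃ k, 2 * (2 * (3 * u + 1 + lam) + 1) + k = n + 5 :=
    ⟨_, Nat.add_sub_of_le (by omega)⟩
  refine ⟨inter, k, 2 * (3 * u + 1 + lam) + 1 + 1, ?_, by push_cast; ring, by omega,
    hCZ.isMinWeight_of_eq_image_Ico hδ hδα hZ (by omega), fun m H hH =>
      (hCZ.rank_mul_hermTranspose hF hδ hδα hH).trans inter.2,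
    hCZ.existsEAQMDS_of_eq_image_Ico hF ⟨5 * u + 3, by ring⟩ hδ hδα hZ lt_n inter.2 hk⟩
  have : (2 * (2 * (3 * u + 1 + lam) + 1) + k : ℚ) = n + 5 := by exact_mod_cast hk
  push_cast
  linarith
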